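/- Let $K$ be a field and let $A=\bigoplus_{i\ge 0}A_i$ be a finite-dimensional non-negatively graded $K$-algebra (associative, unital, not necessarily commutative). Modules are right modules unless said otherwise. Write $A_{>0}=\bigoplus_{i>0}A_i$, let $J_A$ be the Jacobson radical of $A$ (a graded ideal), and for a $\mathbb{Z}$-graded module $X$ and $i\in\mathbb{Z}$ let $X(i)$ be the shift with $X(i)_j=X_{i+j}$. Let $\operatorname{Ext}^n_A(X,Y)_0$ denote the extension groups in the category of $\mathbb{Z}$-graded right $A$-modules with degree-preserving $A$-linear maps, and put $$g(A)=\sup\{\,i\in\mathbb{Z} \mid \operatorname{Ext}^n_A\big((A/J_A)(i),A\big)_0\neq 0\ \text{for some } n\ge 0\,\}.$$ Assume that - $A$ is graded $1$-Iwanaga-Gorenstein, that is, the injective dimensions of $A_A$ and of ${}_AA$ in the categories of $\mathbb{Z}$-graded right, respectively left, $A$-modules are at most $1$; - $\operatorname{gldim}A_0=1$; - the right $A_0$-module $A_{>0}$ has no nonzero projective $A_0$-module as a direct summand. Then $g(A)\le 0$. -/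

import Mathlib

open CategoryTheory CategoryTheory.Limits DirectSum

universe v u w

/-- A sufficient criterion for an internal direct sum decomposition, through projections. -/
theorem isInternal_of_projections {M : Type v} [AddCommGroup M] (D : ℤ → AddSubgroup M)
    (p : ℤ → M → M)
    (hadd : ∀ i x y, p i (x + y) = p i x + p i y)
    (hself : ∀ i x, x ∈ D i → p i x = x)
    (hne : ∀ i j x, i ≠ j → x ∈ D j → p i x = 0)
    (hmem : ∀ i x, p i x ∈ D i)
    (hsum : ∀ x, ∃ s : Finset ℤ, (∀ i ∉ s, p i x = 0) ∧ x = ∑ i ∈ s, p i x) :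
    DirectSum.IsInternal D := by
  classical
  have key : ∀ (z : ⨁ i, D i) (i : ℤ), p i (DirectSum.coeAddMonoidHom D z) = (z i : M) := by
    intro z i
    induction z using DirectSum.induction_on with
    | zero =>
      have := hadd i 0 0
      simp only [add_zero, left_eq_add] at this
      simpa using this
    | of j x =>
      rw [DirectSum.coeAddMonoidHom_of]
      by_cases h : i = j
      · subst h
        rw [hself i _ x.2, DirectSum.of_eq_same]
      · rw [hne i j _ h x.2, DirectSum.of_eq_of_ne _ _ _ h]
        rfl
    | add a b ha hb => rw [map_add, hadd, ha, hb]; rfl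
  constructor
  · intro a b hab
    refine DFinsupp.ext fun i => Subtype.ext ?_
    have := congrArg (p i) hab
    rwa [key, key] at this
  · intro x
    obtain ⟨s, -, hs⟩ := hsum x
    refine ⟨∑ i ∈ s, DirectSum.of (fun i => D i) i ⟨p i x, hmem i x⟩, ?_⟩
    rw [map_sum]
    simp only [DirectSum.coeAddMonoidHom_of]
    exact hs.symm

section GradedModules

variable {K : Type w} {R : Type u} [Field K] [Ring R] [Algebra K R]

/-- `ℤ`-graded left modules over the ring `R` with (the family of homogeneous parts of) the
`ℤ`-grading `𝒜`: an `R`-module which is the internal direct sum of additive subgroups `deg j`,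
such that `𝒜 i • deg j ⊆ deg (i + j)`. Right graded modules over `A` are obtained by taking for
`R` the opposite ring `Aᵐᵒᵖ`. -/
structure GrMod (𝒜 : ℤ → Submodule K R) where
  carrier : Type v
  [addCommGroup : AddCommGroup carrier]
  [module : Module R carrier]
  deg : ℤ → AddSubgroup carrier
  isInternal : DirectSum.IsInternal deg
  smul_mem' : ∀ {i j : ℤ} {r : R} {m : carrier}, r ∈ 𝒜 i → m ∈ deg j → r • m ∈ deg (i + j)

namespace GrMod

variable {𝒜 : ℤ → Submodule K R}

instance : CoeSort (GrMod.{v} 𝒜) (Type v) := ⟨GrMod.carrier⟩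

attribute [instance] GrMod.addCommGroup GrMod.module

/-- Morphisms of graded modules: `R`-linear maps preserving degrees. -/
@[ext]
structure Hom (M N : GrMod.{v} 𝒜) where
  toLin : M →ₗ[R] N
  map_deg : ∀ {i : ℤ} {m : M}, m ∈ M.deg i → toLin m ∈ N.deg i

instance : Category (GrMod.{v} 𝒜) where
  Hom M N := Hom M N
  id _ := ⟨LinearMap.id, fun h => h⟩
  comp f g := ⟨g.toLin.comp f.toLin, fun h => g.map_deg (f.map_deg h)⟩

/-- The underlying linear map of a morphism of graded modules. -/
def lin {M N : GrMod.{v} 𝒜} (f : M ⟶ N) : M →ₗ[R] N := Hom.toLin f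

/-- Constructor for morphisms of graded modules. -/
def homMk {M N : GrMod.{v} 𝒜} (f : M →ₗ[R] N) (hf : ∀ i, ∀ m ∈ M.deg i, f m ∈ N.deg i) :
    M ⟶ N :=
  (⟨f, fun {i m} h => hf i m h⟩ : Hom M N)

@[simp] theorem lin_homMk {M N : GrMod.{v} 𝒜} (f : M →ₗ[R] N) (hf) :
    lin (homMk f hf : M ⟶ N) = f := rfl

theorem lin_mem {M N : GrMod.{v} 𝒜} (f : M ⟶ N) {i : ℤ} {m : M} (h : m ∈ M.deg i) :
    lin f m ∈ N.deg i := Hom.map_deg f h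

theorem hom_ext' {M N : GrMod.{v} 𝒜} {f g : M ⟶ N} (h : lin f = lin g) : f = g :=
  Hom.ext h

@[simp] theorem lin_comp {M N P : GrMod.{v} 𝒜} (f : M ⟶ N) (g : N ⟶ P) :
    lin (f ≫ g) = (lin g).comp (lin f) := rfl

@[simp] theorem lin_id (M : GrMod.{v} 𝒜) : lin (𝟙 M) = LinearMap.id := rfl

instance {M N : GrMod.{v} 𝒜} : Zero (M ⟶ N) :=
  ⟨homMk 0 fun i _ _ => (N.deg i).zero_mem⟩

instance {M N : GrMod.{v} 𝒜} : Add (M ⟶ N) :=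
  ⟨fun f g => homMk (lin f + lin g) fun i _ h => (N.deg i).add_mem (lin_mem f h) (lin_mem g h)⟩

instance {M N : GrMod.{v} 𝒜} : Neg (M ⟶ N) :=
  ⟨fun f => homMk (-lin f) fun i _ h => (N.deg i).neg_mem (lin_mem f h)⟩

instance {M N : GrMod.{v} 𝒜} : Sub (M ⟶ N) :=
  ⟨fun f g => homMk (lin f - lin g) fun i _ h => (N.deg i).sub_mem (lin_mem f h) (lin_mem g h)⟩

instance {M N : GrMod.{v} 𝒜} : SMul ℕ (M ⟶ N) :=
  ⟨fun n f => homMk (n • lin f) fun i _ h => (N.deg i).nsmul_mem (lin_mem f h) n⟩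

instance {M N : GrMod.{v} 𝒜} : SMul ℤ (M ⟶ N) :=
  ⟨fun n f => homMk (n • lin f) fun i _ h => (N.deg i).zsmul_mem (lin_mem f h) n⟩

instance {M N : GrMod.{v} 𝒜} : AddCommGroup (M ⟶ N) :=
  Function.Injective.addCommGroup (fun f : M ⟶ N => lin f) (fun _ _ h => hom_ext' h)
    rfl (fun _ _ => rfl) (fun _ => rfl) (fun _ _ => rfl) (fun _ _ => rfl) (fun _ _ => rfl)

@[simp] theorem lin_zero {M N : GrMod.{v} 𝒜} : lin (0 : M ⟶ N) = 0 := rfl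

@[simp] theorem lin_add {M N : GrMod.{v} 𝒜} (f g : M ⟶ N) : lin (f + g) = lin f + lin g := rfl

instance : Preadditive (GrMod.{v} 𝒜) where
  add_comp _ _ _ f f' g := hom_ext' (by ext; simp)
  comp_add _ _ _ f g g' := hom_ext' (by ext; simp)

/-- The decomposition of a graded module as a direct sum. -/
noncomputable def decomp (M : GrMod.{v} 𝒜) : M ≃+ ⨁ i, M.deg i :=
  (AddEquiv.ofBijective (DirectSum.coeAddMonoidHom M.deg) M.isInternal).symm

theorem decomp_symm (M : GrMod.{v} 𝒜) (z : ⨁ i, M.deg i) :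
    M.decomp.symm z = DirectSum.coeAddMonoidHom M.deg z := rfl

/-- The homogeneous component of degree `i` of an element of a graded module. -/
noncomputable def comp (M : GrMod.{v} 𝒜) (i : ℤ) (m : M) : M := M.decomp m i

theorem comp_add (M : GrMod.{v} 𝒜) (i : ℤ) (x y : M) :
    M.comp i (x + y) = M.comp i x + M.comp i y := by
  rw [comp, map_add]
  rfl

theorem comp_mem (M : GrMod.{v} 𝒜) (i : ℤ) (x : M) : M.comp i x ∈ M.deg i :=
  SetLike.coe_mem _

theorem decomp_of_mem (M : GrMod.{v} 𝒜) {j : ℤ} {x : M} (h : x ∈ M.deg j) :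
    M.decomp x = DirectSum.of (fun i => M.deg i) j ⟨x, h⟩ := by
  rw [← AddEquiv.eq_symm_apply, decomp_symm, DirectSum.coeAddMonoidHom_of]

theorem comp_self (M : GrMod.{v} 𝒜) (i : ℤ) (x : M) (h : x ∈ M.deg i) : M.comp i x = x := by
  rw [comp, decomp_of_mem M h, DirectSum.of_eq_same]

theorem comp_ne (M : GrMod.{v} 𝒜) (i j : ℤ) (x : M) (hij : i ≠ j) (h : x ∈ M.deg j) :
    M.comp i x = 0 := by
  rw [comp, decomp_of_mem M h, DirectSum.of_eq_of_ne _ _ _ hij]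
  rfl

theorem comp_sum (M : GrMod.{v} 𝒜) (x : M) :
    ∃ s : Finset ℤ, (∀ i ∉ s, M.comp i x = 0) ∧ x = ∑ i ∈ s, M.comp i x := by
  classical
  set z := M.decomp x with hz
  refine ⟨DFinsupp.support z, fun i hi => ?_, ?_⟩
  · have h0 : z i = 0 := by simpa using hi
    have : M.comp i x = (z i : M) := rfl
    rw [this, h0]
    rfl
  · have h1 : DirectSum.coeAddMonoidHom M.deg z = x := M.decomp.symm_apply_apply x
    conv_lhs => rw [← h1, ← DirectSum.sum_support_of z, map_sum]
    refine Finset.sum_congr rfl fun i _ => ?_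
    rw [DirectSum.coeAddMonoidHom_of]
    rfl

theorem comp_zero (M : GrMod.{v} 𝒜) (i : ℤ) : M.comp i 0 = 0 :=
  M.comp_self i 0 (M.deg i).zero_mem

theorem comp_sum_apply (M : GrMod.{v} 𝒜) (i : ℤ) (s : Finset ℤ) (x : ℤ → M) :
    M.comp i (∑ j ∈ s, x j) = ∑ j ∈ s, M.comp i (x j) :=
  map_sum (AddMonoidHom.mk' (M.comp i) (M.comp_add i)) x s

theorem comp_lin {M N : GrMod.{v} 𝒜} (f : M ⟶ N) (i : ℤ) (x : M) :
    N.comp i (lin f x) = lin f (M.comp i x) := by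
  obtain ⟨s, hs0, hs⟩ := M.comp_sum x
  have h1 : lin f x = ∑ j ∈ s, lin f (M.comp j x) := by
    conv_lhs => rw [hs, map_sum]
  rw [h1, comp_sum_apply]
  have h2 : ∀ j ∈ s, j ≠ i → N.comp i (lin f (M.comp j x)) = 0 := fun j _ hj =>
    N.comp_ne i j _ hj.symm (lin_mem f (M.comp_mem j x))
  by_cases his : i ∈ s
  · rw [Finset.sum_eq_single_of_mem i his h2]
    exact N.comp_self i _ (lin_mem f (M.comp_mem i x))
  · rw [hs0 i his, map_zero]
    exact Finset.sum_eq_zero fun j hj => h2 j hj fun h => his (h ▸ hj)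

/-- A submodule is homogeneous if it contains all homogeneous components of its elements. -/
def IsHomogeneousSub (M : GrMod.{v} 𝒜) (N : Submodule R M) : Prop :=
  ∀ i, ∀ x ∈ N, M.comp i x ∈ N

/-- The graded module given by a homogeneous submodule. -/
def sub (M : GrMod.{v} 𝒜) (N : Submodule R M) (hN : M.IsHomogeneousSub N) : GrMod.{v} 𝒜 where
  carrier := N
  deg i := (M.deg i).comap N.subtype.toAddMonoidHom
  isInternal := by
    refine isInternal_of_projections _ (fun i x => ⟨M.comp i x, hN i x x.2⟩) ?_ ?_ ?_ ?_ ?_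
    · exact fun i x y => Subtype.ext (M.comp_add i x y)
    · exact fun i x h => Subtype.ext (M.comp_self i x h)
    · exact fun i j x hij h => Subtype.ext (M.comp_ne i j x hij h)
    · exact fun i x => M.comp_mem i x
    · intro x
      obtain ⟨s, h0, hs⟩ := M.comp_sum x
      refine ⟨s, fun i hi => Subtype.ext (h0 i hi), Subtype.ext ?_⟩
      rw [AddSubmonoidClass.coe_finsetSum]
      exact hs
  smul_mem' hr hm := M.smul_mem' hr hm

/-- The quotient of a graded module by a homogeneous submodule; its part of degree `i` is the image
of the part of degree `i`. -/
def quot (M : GrMod.{v} 𝒜) (N : Submodule R M) (hN : M.IsHomogeneousSub N) : GrMod.{v} 𝒜 where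
  carrier := M ⧸ N
  deg i := (M.deg i).map N.mkQ.toAddMonoidHom
  isInternal := by
    let q : ℤ → (M ⧸ N) →+ (M ⧸ N) := fun i =>
      QuotientAddGroup.map N.toAddSubgroup N.toAddSubgroup
        (AddMonoidHom.mk' (M.comp i) (M.comp_add i)) (fun x hx => hN i x hx)
    have hq : ∀ i x, q i (N.mkQ x) = N.mkQ (M.comp i x) := fun i x => rfl
    refine isInternal_of_projections _ (fun i x => q i x) ?_ ?_ ?_ ?_ ?_
    · exact fun i x y => map_add _ _ _
    · rintro i _ ⟨x, hx, rfl⟩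
      exact (hq i x).trans (congrArg N.mkQ (M.comp_self i x hx))
    · rintro i j _ hij ⟨x, hx, rfl⟩
      exact (hq i x).trans ((congrArg N.mkQ (M.comp_ne i j x hij hx)).trans (map_zero _))
    · intro i x
      obtain ⟨x, rfl⟩ := N.mkQ_surjective x
      exact ⟨M.comp i x, M.comp_mem i x, rfl⟩
    · intro x
      obtain ⟨x, rfl⟩ := N.mkQ_surjective x
      obtain ⟨s, h0, hs⟩ := M.comp_sum x
      refine ⟨s, fun i hi => ?_, ?_⟩
      · rw [hq, h0 i hi, map_zero]
      · simp only [hq]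
        rw [← map_sum, ← hs]
  smul_mem' := by
    rintro i j r _ hr ⟨m, hm, rfl⟩
    exact ⟨r • m, M.smul_mem' hr hm, map_smul N.mkQ r m⟩

/-- The degree shift `M(n)`, with `M(n)_i = M_{n + i}`. -/
def shift (M : GrMod.{v} 𝒜) (n : ℤ) : GrMod.{v} 𝒜 where
  carrier := M
  deg i := M.deg (i + n)
  isInternal := by
    refine isInternal_of_projections _ (fun i x => M.comp (i + n) x) ?_ ?_ ?_ ?_ ?_
    · exact fun i x y => M.comp_add _ x y
    · exact fun i x h => M.comp_self _ x h
    · exact fun i j x hij h => M.comp_ne _ (j + n) x (by simpa using hij) h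
    · exact fun i x => M.comp_mem _ x
    · intro x
      obtain ⟨s, h0, hs⟩ := M.comp_sum x
      refine ⟨s.map (Equiv.subRight n).toEmbedding, fun i hi => h0 _ fun h => hi ?_, ?_⟩
      · rw [Finset.mem_map_equiv]
        simpa using h
      · rw [Finset.sum_map]
        simpa using hs
  smul_mem' {i j r m} hr hm := by
    rw [add_assoc]
    exact M.smul_mem' hr hm

/-- The direct sum of two graded modules. -/
def prod (M N : GrMod.{v} 𝒜) : GrMod.{v} 𝒜 where
  carrier := M × N
  deg i := (M.deg i).prod (N.deg i)
  isInternal := by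
    classical
    refine isInternal_of_projections _ (fun i x => (M.comp i x.1, N.comp i x.2)) ?_ ?_ ?_ ?_ ?_
    · exact fun i x y => Prod.ext (M.comp_add _ _ _) (N.comp_add _ _ _)
    · exact fun i x h => Prod.ext (M.comp_self _ _ h.1) (N.comp_self _ _ h.2)
    · exact fun i j x hij h => Prod.ext (M.comp_ne _ _ _ hij h.1) (N.comp_ne _ _ _ hij h.2)
    · exact fun i x => ⟨M.comp_mem _ _, N.comp_mem _ _⟩
    · intro x
      obtain ⟨s, h0, hs⟩ := M.comp_sum x.1
      obtain ⟨t, k0, ht⟩ := N.comp_sum x.2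
      refine ⟨s ∪ t, fun i hi => ?_, ?_⟩
      · rw [Finset.notMem_union] at hi
        exact Prod.ext (h0 i hi.1) (k0 i hi.2)
      · refine Prod.ext ?_ ?_
        · rw [Prod.fst_sum, ← Finset.sum_subset Finset.subset_union_left fun i _ hi => h0 i hi]
          exact hs
        · rw [Prod.snd_sum, ← Finset.sum_subset Finset.subset_union_right fun i _ hi => k0 i hi]
          exact ht
  smul_mem' hr hm := ⟨M.smul_mem' hr hm.1, N.smul_mem' hr hm.2⟩

/-- The zero graded module. -/
def zero : GrMod.{v} 𝒜 where
  carrier := PUnit.{v + 1}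
  deg _ := ⊤
  isInternal :=
    isInternal_of_projections _ (fun _ _ => PUnit.unit) (fun _ _ _ => rfl) (fun _ _ _ => rfl)
      (fun _ _ _ _ _ => rfl) (fun _ _ => trivial) (fun _ => ⟨∅, fun _ _ => rfl, rfl⟩)
  smul_mem' _ _ := trivial

instance : HasTerminal (GrMod.{v} 𝒜) :=
  (IsTerminal.ofUniqueHom (Y := (zero : GrMod.{v} 𝒜)) (fun _ => 0)
    (fun _ _ => hom_ext' (LinearMap.ext fun _ => rfl))).hasTerminal

instance : HasBinaryBiproducts (GrMod.{v} 𝒜) where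
  has_binary_biproduct M N :=
    hasBinaryBiproduct_of_total
      { pt := prod M N
        fst := homMk (M := prod M N) (LinearMap.fst R M N) fun _ _ h => h.1
        snd := homMk (M := prod M N) (LinearMap.snd R M N) fun _ _ h => h.2
        inl := homMk (N := prod M N) (LinearMap.inl R M N) fun i _ h => ⟨h, (N.deg i).zero_mem⟩
        inr := homMk (N := prod M N) (LinearMap.inr R M N) fun i _ h => ⟨(M.deg i).zero_mem, h⟩
        inl_fst := rfl
        inl_snd := rfl
        inr_fst := rfl
        inr_snd := rfl }
      (hom_ext' (LinearMap.ext fun x => by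
        change (x.1 + 0, 0 + x.2) = x
        rw [add_zero, zero_add]
        rfl))

instance : HasFiniteProducts (GrMod.{v} 𝒜) :=
  haveI : HasBinaryProducts (GrMod.{v} 𝒜) := hasBinaryProducts_of_hasBinaryBiproducts
  hasFiniteProducts_of_has_binary_and_terminal

section KernelCokernel

variable {M N : GrMod.{v} 𝒜} (f : M ⟶ N)

theorem isHomogeneousSub_ker : M.IsHomogeneousSub (LinearMap.ker (lin f)) := by
  intro i x hx
  rw [LinearMap.mem_ker] at hx ⊢
  rw [← comp_lin, hx, comp_zero]

theorem isHomogeneousSub_range : N.IsHomogeneousSub (LinearMap.range (lin f)) := by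
  rintro i _ ⟨x, rfl⟩
  exact ⟨M.comp i x, (comp_lin f i x).symm⟩

/-- The kernel of a morphism of graded modules. -/
def ker : GrMod.{v} 𝒜 := M.sub (LinearMap.ker (lin f)) (isHomogeneousSub_ker f)

/-- The inclusion of the kernel. -/
def kerι : ker f ⟶ M :=
  homMk (M := ker f) (LinearMap.ker (lin f)).subtype fun _ _ h => h

theorem kerι_comp : kerι f ≫ f = 0 :=
  hom_ext' (LinearMap.ext fun x => LinearMap.mem_ker.1 x.2)

/-- The kernel has its universal property. -/
def kerIsLimit : IsLimit (KernelFork.ofι (kerι f) (kerι_comp f)) :=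
  KernelFork.IsLimit.ofι _ _
    (fun {W} g hg => homMk (M := W) (N := ker f)
      (LinearMap.codRestrict (LinearMap.ker (lin f)) (lin g)
        (fun x => LinearMap.mem_ker.2 (LinearMap.congr_fun (congrArg lin hg) x)))
      (fun _ _ h => lin_mem g h))
    (fun _ _ => rfl)
    (fun _ _ _ hm => hom_ext' (LinearMap.ext fun x =>
      Subtype.ext (LinearMap.congr_fun (congrArg lin hm) x)))

/-- The cokernel of a morphism of graded modules. -/
def coker : GrMod.{v} 𝒜 := N.quot (LinearMap.range (lin f)) (isHomogeneousSub_range f)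

/-- The projection to the cokernel. -/
def cokerπ : N ⟶ coker f :=
  homMk (N := coker f) (LinearMap.range (lin f)).mkQ fun _ m h => ⟨m, h, rfl⟩

theorem comp_cokerπ : f ≫ cokerπ f = 0 :=
  hom_ext' (LinearMap.ext fun x => (Submodule.Quotient.mk_eq_zero _).2 ⟨x, rfl⟩)

/-- The cokernel has its universal property. -/
def cokerIsColimit : IsColimit (CokernelCofork.ofπ (cokerπ f) (comp_cokerπ f)) :=
  CokernelCofork.IsColimit.ofπ _ _
    (fun {W} g hg => homMk (M := coker f) (N := W)
      ((LinearMap.range (lin f)).liftQ (lin g) (by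
        rintro _ ⟨x, rfl⟩
        exact LinearMap.mem_ker.2 (LinearMap.congr_fun (congrArg lin hg) x)))
      (by
        rintro i _ ⟨m, hm, rfl⟩
        exact lin_mem g hm))
    (fun _ _ => rfl)
    (fun _ _ _ hm => hom_ext' (Submodule.linearMap_qext _ (congrArg lin hm)))

theorem injective_of_mono [Mono f] : Function.Injective (lin f) := by
  have h : kerι f = 0 := (cancel_mono f).1 (by rw [kerι_comp, zero_comp])
  rw [← LinearMap.ker_eq_bot, eq_bot_iff]
  intro x hx
  exact LinearMap.congr_fun (congrArg lin h) (⟨x, hx⟩ : LinearMap.ker (lin f))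

theorem surjective_of_epi [Epi f] : Function.Surjective (lin f) := by
  have h : cokerπ f = 0 := (cancel_epi f).1 (by rw [comp_cokerπ, CategoryTheory.Limits.comp_zero])
  rw [← LinearMap.range_eq_top, eq_top_iff]
  intro x _
  exact (Submodule.Quotient.mk_eq_zero _).1 (LinearMap.congr_fun (congrArg lin h) x)

/-- A monomorphism is the kernel of its cokernel. -/
noncomputable def monoIsLimit [Mono f] : IsLimit (KernelFork.ofι f (comp_cokerπ f)) :=
  KernelFork.IsLimit.ofι' f _ fun {W} k hk =>
    let e := LinearEquiv.ofInjective (lin f) (injective_of_mono f)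
    have hr : ∀ x, lin k x ∈ LinearMap.range (lin f) := fun x =>
      (Submodule.Quotient.mk_eq_zero _).1 (LinearMap.congr_fun (congrArg lin hk) x)
    let l : W →ₗ[R] M := e.symm.toLinearMap.comp (LinearMap.codRestrict _ (lin k) hr)
    have hl : ∀ x, lin f (l x) = lin k x := fun x =>
      congrArg Subtype.val (e.apply_symm_apply ⟨lin k x, hr x⟩)
    ⟨homMk l (by
      intro i m hm
      have : M.comp i (l m) = l m := by
        apply injective_of_mono f
        rw [← comp_lin, hl]
        exact N.comp_self i _ (lin_mem k hm)
      rw [← this]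
      exact M.comp_mem i _), hom_ext' (LinearMap.ext hl)⟩

/-- An epimorphism is the cokernel of its kernel. -/
noncomputable def epiIsColimit [Epi f] : IsColimit (CokernelCofork.ofπ f (kerι_comp f)) :=
  CokernelCofork.IsColimit.ofπ' f _ fun {W} k hk =>
    let e := (lin f).quotKerEquivOfSurjective (surjective_of_epi f)
    let l' : (M ⧸ LinearMap.ker (lin f)) →ₗ[R] W :=
      (LinearMap.ker (lin f)).liftQ (lin k) (fun x hx =>
        LinearMap.mem_ker.2 (LinearMap.congr_fun (congrArg lin hk)
          (⟨x, hx⟩ : LinearMap.ker (lin f))))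
    let l : N →ₗ[R] W := l'.comp e.symm.toLinearMap
    have hl : ∀ x, l (lin f x) = lin k x := fun x => by
      have : e.symm (lin f x) = (LinearMap.ker (lin f)).mkQ x := by
        rw [LinearEquiv.symm_apply_eq]
        rfl
      change l' (e.symm (lin f x)) = _
      rw [this]
      rfl
    ⟨homMk l (by
      intro i n hn
      obtain ⟨m, rfl⟩ := surjective_of_epi f n
      rw [← N.comp_self i _ hn, comp_lin, hl]
      exact lin_mem k (M.comp_mem i m)), hom_ext' (LinearMap.ext hl)⟩

end KernelCokernel

noncomputable instance : Abelian (GrMod.{v} 𝒜) where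
  normalMonoOfMono f _ := ⟨⟨_, _, _, monoIsLimit f⟩⟩
  normalEpiOfEpi f _ := ⟨⟨_, _, _, epiIsColimit f⟩⟩
  has_kernels := ⟨fun f => ⟨⟨⟨_, kerIsLimit f⟩⟩⟩⟩
  has_cokernels := ⟨fun f => ⟨⟨⟨_, cokerIsColimit f⟩⟩⟩⟩

end GrMod

end GradedModules

section GradedAlgebras

variable {K : Type w} {A : Type u} [Field K] [Ring A] [Algebra K A]

/-- A `ℤ`-graded algebra is non-negatively graded if `A_i = 0` for all `i < 0`. -/
class IsNonnegGraded (𝒜 : ℤ → Submodule K A) : Prop where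
  eq_bot_of_neg : ∀ i < 0, 𝒜 i = ⊥

/-- The grading of the opposite algebra: `(Aᵐᵒᵖ)_i = A_i`. -/
def opGrading (𝒜 : ℤ → Submodule K A) (i : ℤ) : Submodule K Aᵐᵒᵖ :=
  (𝒜 i).comap (MulOpposite.opLinearEquiv K).symm.toLinearMap

theorem mem_opGrading {𝒜 : ℤ → Submodule K A} {i : ℤ} {x : Aᵐᵒᵖ} :
    x ∈ opGrading 𝒜 i ↔ x.unop ∈ 𝒜 i := Iff.rfl

theorem isInternal_grading (𝒜 : ℤ → Submodule K A) [GradedAlgebra 𝒜] :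
    DirectSum.IsInternal fun i => (𝒜 i).toAddSubgroup := by
  classical
  refine isInternal_of_projections _ (fun i x => (DirectSum.decompose 𝒜 x i : A)) ?_ ?_ ?_ ?_ ?_
  · intro i x y
    simp
  · exact fun i x h => DirectSum.decompose_of_mem_same 𝒜 h
  · exact fun i j x hij h => DirectSum.decompose_of_mem_ne 𝒜 h hij.symm
  · exact fun i x => SetLike.coe_mem _
  · exact fun x => ⟨DFinsupp.support (DirectSum.decompose 𝒜 x), fun i hi => by
      simpa using hi, (DirectSum.sum_support_decompose 𝒜 x).symm⟩

instance (𝒜 : ℤ → Submodule K A) [IsNonnegGraded 𝒜] : IsNonnegGraded (opGrading 𝒜) where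
  eq_bot_of_neg i hi := by
    rw [eq_bot_iff]
    intro x hx
    rw [mem_opGrading, IsNonnegGraded.eq_bot_of_neg (𝒜 := 𝒜) i hi, Submodule.mem_bot] at hx
    exact MulOpposite.unop_injective hx

theorem isInternal_opGrading (𝒜 : ℤ → Submodule K A) [GradedAlgebra 𝒜] :
    DirectSum.IsInternal (opGrading 𝒜) := by
  classical
  have h : DirectSum.IsInternal fun i => (opGrading 𝒜 i).toAddSubgroup := by
    refine isInternal_of_projections _
      (fun i x => MulOpposite.op (DirectSum.decompose 𝒜 x.unop i : A)) ?_ ?_ ?_ ?_ ?_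
    · intro i x y
      simp
    · exact fun i x h => MulOpposite.unop_injective (DirectSum.decompose_of_mem_same 𝒜 h)
    · exact fun i j x hij h =>
        MulOpposite.unop_injective (DirectSum.decompose_of_mem_ne 𝒜 h hij.symm)
    · exact fun i x => SetLike.coe_mem (DirectSum.decompose 𝒜 x.unop i)
    · refine fun x => ⟨DFinsupp.support (DirectSum.decompose 𝒜 x.unop), fun i hi => ?_, ?_⟩
      · simpa using hi
      · apply MulOpposite.unop_injective
        refine (DirectSum.sum_support_decompose 𝒜 x.unop).symm.trans ?_
        exact (map_sum (MulOpposite.opAddEquiv (α := A)).symm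
          (fun i => MulOpposite.op (DirectSum.decompose 𝒜 x.unop i : A))
          (DFinsupp.support (DirectSum.decompose 𝒜 x.unop))).symm
  exact h

noncomputable instance (𝒜 : ℤ → Submodule K A) [GradedAlgebra 𝒜] :
    GradedAlgebra (opGrading 𝒜) where
  one_mem := SetLike.GradedOne.one_mem (A := 𝒜)
  mul_mem i j x y hx hy := by
    rw [add_comm]
    exact SetLike.GradedMul.mul_mem (A := 𝒜) hy hx
  toDecomposition := (isInternal_opGrading 𝒜).chooseDecomposition

/-- The algebra as a graded left module over itself. -/
def regularGrMod (𝒜 : ℤ → Submodule K A) [GradedAlgebra 𝒜] : GrMod.{u} 𝒜 where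
  carrier := A
  deg i := (𝒜 i).toAddSubgroup
  isInternal := isInternal_grading 𝒜
  smul_mem' hr hm := SetLike.GradedMul.mul_mem hr hm

theorem regularGrMod_comp (𝒜 : ℤ → Submodule K A) [GradedAlgebra 𝒜] (i : ℤ) (x : A) :
    (regularGrMod 𝒜).comp i x = (DirectSum.decompose 𝒜 x i : A) := by
  classical
  have h : ∀ y : A, (regularGrMod 𝒜).comp i y = (DirectSum.decompose 𝒜 y i : A) := by
    intro y
    induction y using DirectSum.Decomposition.inductionOn 𝒜 with
    | zero => rw [DirectSum.decompose_zero]; exact (regularGrMod 𝒜).comp_zero i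
    | @homogeneous j m =>
      by_cases hij : i = j
      · subst hij
        rw [DirectSum.decompose_of_mem_same 𝒜 m.2]
        exact (regularGrMod 𝒜).comp_self i _ m.2
      · rw [DirectSum.decompose_of_mem_ne 𝒜 m.2 (Ne.symm hij)]
        exact (regularGrMod 𝒜).comp_ne i j _ hij m.2
    | add a b ha hb =>
      refine ((regularGrMod 𝒜).comp_add i a b).trans ?_
      rw [ha, hb, DirectSum.decompose_add]
      rfl
  exact h x

theorem eq_zero_of_eq_bot {p : Submodule K A} (h : p = ⊥) (y : p) : y = 0 := by
  subst h
  exact Subsingleton.elim _ _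

theorem pos_mem_jacobson [FiniteDimensional K A] (𝒜 : ℤ → Submodule K A) [GradedAlgebra 𝒜]
    [IsNonnegGraded 𝒜] {i : ℤ} (hi : 0 < i) {x : A} (hx : x ∈ 𝒜 i) : x ∈ Ring.jacobson A := by
  classical
  have hind : iSupIndep 𝒜 := (DirectSum.Decomposition.isInternal 𝒜).submodule_iSupIndep
  obtain ⟨N, hN⟩ := (WellFoundedGT.finite_ne_bot_of_iSupIndep hind).bddAbove
  have hneg : ∀ y : A, ∀ j < (0 : ℤ), DirectSum.decompose 𝒜 y j = 0 := by
    intro y j hj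
    exact eq_zero_of_eq_bot (IsNonnegGraded.eq_bot_of_neg j hj) _
  have hx1 : ∀ j < (1 : ℤ), DirectSum.decompose 𝒜 x j = 0 := fun j hj =>
    Subtype.ext (DirectSum.decompose_of_mem_ne 𝒜 hx (by omega))
  have hnil : ∀ y : A, IsNilpotent (y * x) := by
    intro y
    have h1 : ∀ j < (1 : ℤ), DirectSum.decompose 𝒜 (y * x) j = 0 := by
      intro j hj
      rw [DirectSum.decompose_mul]
      exact mul_apply_eq_zero (hneg y) hx1 (by omega)
    have hpow : ∀ n : ℕ, ∀ j < (n : ℤ), DirectSum.decompose 𝒜 ((y * x) ^ n) j = 0 := by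
      intro n
      induction n with
      | zero => exact fun j hj => hneg _ j (by simpa using hj)
      | succ n ih =>
        intro j hj
        rw [pow_succ, DirectSum.decompose_mul]
        exact mul_apply_eq_zero ih h1 (by push_cast at hj; exact hj)
    refine ⟨N.toNat + 1, (DirectSum.decompose 𝒜).injective ?_⟩
    rw [DirectSum.decompose_zero]
    refine DFinsupp.ext fun j => ?_
    by_cases hj : j < ((N.toNat + 1 : ℕ) : ℤ)
    · exact hpow _ j hj
    · have hb : 𝒜 j = ⊥ := by
        by_contra hne
        have := hN hne
        push_cast at hj
        omega
      exact eq_zero_of_eq_bot hb _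
  rw [← Ideal.jacobson_bot, Ideal.mem_jacobson_iff]
  intro y
  obtain ⟨u, hu⟩ := (hnil y).isUnit_one_add
  refine ⟨(↑u⁻¹ : A), ?_⟩
  rw [Submodule.mem_bot]
  have h : (↑u⁻¹ : A) * (1 + y * x) = 1 := by rw [← hu, Units.inv_mul]
  rw [← h]
  noncomm_ring

/-- The Jacobson radical of a finite dimensional non-negatively graded algebra is homogeneous. -/
theorem isHomogeneousSub_jacobson [FiniteDimensional K A] (𝒜 : ℤ → Submodule K A)
    [GradedAlgebra 𝒜] [IsNonnegGraded 𝒜] :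
    (regularGrMod 𝒜).IsHomogeneousSub (Ring.jacobson A) := by
  classical
  have hne : ∀ (x : A) (j : ℤ), j ≠ 0 → (DirectSum.decompose 𝒜 x j : A) ∈ Ring.jacobson A := by
    intro x j hj
    have hm := (DirectSum.decompose 𝒜 x j).2
    rcases lt_or_gt_of_ne hj with h | h
    · rw [eq_zero_of_eq_bot (IsNonnegGraded.eq_bot_of_neg j h) (DirectSum.decompose 𝒜 x j)]
      exact zero_mem _
    · exact pos_mem_jacobson 𝒜 h hm
  have key : ∀ (i : ℤ) (x : A), x ∈ Ring.jacobson A →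
      (DirectSum.decompose 𝒜 x i : A) ∈ Ring.jacobson A := by
    intro i x hx
    by_cases hi : i = 0
    · subst hi
      by_cases h0 : (0 : ℤ) ∈ DFinsupp.support (DirectSum.decompose 𝒜 x)
      · have h1 := DirectSum.sum_support_decompose 𝒜 x
        rw [← Finset.add_sum_erase _ _ h0] at h1
        rw [eq_sub_of_add_eq h1]
        exact sub_mem hx (sum_mem fun j hj => hne x j (Finset.ne_of_mem_erase hj))
      · have : DirectSum.decompose 𝒜 x 0 = 0 := by simpa using h0
        rw [this]
        exact zero_mem _
    · exact hne x i hi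
  intro i x hx
  have := regularGrMod_comp 𝒜 i x
  rw [this]
  exact key i x hx

/-- The graded module `A/J_A`, where `J_A` is the Jacobson radical. -/
def topGrMod [FiniteDimensional K A] (𝒜 : ℤ → Submodule K A) [GradedAlgebra 𝒜]
    [IsNonnegGraded 𝒜] : GrMod.{u} 𝒜 :=
  (regularGrMod 𝒜).quot (Ring.jacobson A) (isHomogeneousSub_jacobson 𝒜)

/-- The number `g(M)` of a graded left module `M`, as an extended integer: the supremum of the
integers `i` such that `Ext^n(A/J_A(i), M) ≠ 0` for some `n ≥ 0`, where `Ext` is computed in the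
category of graded modules and degree-preserving morphisms. -/
noncomputable def gNumber [FiniteDimensional K A] (𝒜 : ℤ → Submodule K A) [GradedAlgebra 𝒜]
    [IsNonnegGraded 𝒜] (M : GrMod.{u} 𝒜) : EInt :=
  letI := HasExt.standard (GrMod.{u} 𝒜)
  sSup {x : EInt | ∃ i : ℤ, x = (i : EInt) ∧
    ∃ n : ℕ, Nontrivial (Abelian.Ext ((topGrMod 𝒜).shift i) M n)}

/-- The number `g(A) = g(A_A)`, where `A_A` is `A` as a graded right module over itself, that is, as
a graded left module over `Aᵐᵒᵖ`. -/
noncomputable def gRight [FiniteDimensional K A] (𝒜 : ℤ → Submodule K A) [GradedAlgebra 𝒜]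
    [IsNonnegGraded 𝒜] : EInt :=
  gNumber (opGrading 𝒜) (regularGrMod (opGrading 𝒜))

/-- Graded `d`-Iwanaga-Gorenstein algebras: the graded injective dimensions of `A` as a right and
as a left graded module over itself are at most `d`. -/
def IsGradedIG (𝒜 : ℤ → Submodule K A) [GradedAlgebra 𝒜] (d : ℕ) : Prop :=
  HasInjectiveDimensionLE (regularGrMod (opGrading 𝒜)) d ∧
    HasInjectiveDimensionLE (regularGrMod 𝒜) d

/-- The (left) global dimension of a ring; for right modules use the opposite ring. -/
noncomputable def globalDim (R : Type u) [Ring R] : WithBot ℕ∞ :=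
  ⨆ M : ModuleCat.{u} R, projectiveDimension M

/-- `A_{>0}`, the sum of all `A_i` with `i > 0`. -/
def positivePart (𝒜 : ℤ → Submodule K A) : Submodule K A := ⨆ i : {i : ℤ // 0 < i}, 𝒜 i

theorem mul_mem_positivePart (𝒜 : ℤ → Submodule K A) [GradedAlgebra 𝒜] {x a : A}
    (hx : x ∈ positivePart 𝒜) (ha : a ∈ 𝒜 0) : x * a ∈ positivePart 𝒜 := by
  have : positivePart 𝒜 ≤ (positivePart 𝒜).comap (LinearMap.mulRight K a) := by
    refine iSup_le fun i y hy => ?_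
    have h : y * a ∈ 𝒜 i := by simpa using SetLike.GradedMul.mul_mem hy ha
    exact Submodule.mem_iSup_of_mem (p := fun i : {i : ℤ // 0 < i} => 𝒜 i) i h
  exact this hx

/-- `A_{>0}` as a right `A_0`-module. -/
instance (𝒜 : ℤ → Submodule K A) [GradedAlgebra 𝒜] : Module (𝒜 0)ᵐᵒᵖ (positivePart 𝒜) where
  smul a x := ⟨(x : A) * (a.unop : A), mul_mem_positivePart 𝒜 x.2 a.unop.2⟩
  one_smul x := Subtype.ext (mul_one (x : A))
  mul_smul a b x := Subtype.ext (mul_assoc (x : A) (b.unop : A) (a.unop : A)).symm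
  smul_zero a := Subtype.ext (zero_mul (a.unop : A))
  smul_add a x y := Subtype.ext (add_mul (x : A) (y : A) (a.unop : A))
  add_smul a b x := Subtype.ext (mul_add (x : A) (a.unop : A) (b.unop : A))
  zero_smul x := Subtype.ext (mul_zero (x : A))

end GradedAlgebras

/-! Put R = Aᵒᵖ, S = A, let D be the graded dual over the base field (it swaps left modules over R
and S), and let i > 0. The module (A/J)(i) lives in degree -i < 0, so it has no nonzero map to the
non-negatively graded R. Its Ext groups of order at least 2 vanish by the injective dimension bound,
so only Ext¹ matters.

Injective dimension at most one makes vanishing of Ext¹(-, R) pass to subobjects. A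
finite-dimensional module X in degree -n, with n > 0, has for each nonzero functional a map to DS(n)
whose kernel is smaller than X. Induction on dimension (`subsingleton_ext_of_concentrated`)
therefore reduces everything to Ext¹(DS(n), R) = 0.

Let Ω be the kernel of a graded free cover F → DS. As DS lives in degrees ≤ 0, the basis of F can be
taken there too. It suffices that Hom(Ω(n), R) = 0. Dualizing the cover gives 0 → S → DF → DΩ → 0
with DF injective, so DΩ is injective because S has injective dimension at most one
(`injective_dual_ker`).

A nonzero map Ω(n) → R dualizes to a nonzero map DR → DΩ of degree -n. On the highest degree where
it is nonzero, its values are killed by positive-degree elements, so DΩ has a simple submodule N in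
some degree -j < 0 (`hom_ker_shift_eq_zero`). Now N embeds in DR(j), landing in the part D(R₀), and
by injectivity the inclusion N → DΩ extends to φ : DR(j) → DΩ (`eq_zero_of_positive_smul_eq_zero`).
On that part φ is a map D(R₀) → D(Ω_j). As DS vanishes in degree j, Ω_j = F_j is a sum of parts of R
of positive degree, so φ is there dual to R₀-linear maps from positive parts of R to R₀
(`map_dual_regular_eq_zero`).

These maps are zero: A₀ is hereditary, so the image of such a map is projective and splits off
A_{>0} (`noPositiveToZero_opGrading`). Hence φ kills N, a contradiction. -/

/-! ### Graded modules: components, shifts and graded free modules -/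

namespace GrMod

variable {K : Type w} {R : Type u} [Field K] [Ring R] [Algebra K R] {𝒜 : ℤ → Submodule K R}

/-- An element of a graded module is determined by its homogeneous components. -/
theorem ext_comp (M : GrMod.{v} 𝒜) {x y : M} (h : ∀ i, M.comp i x = M.comp i y) : x = y := by
  have hd : M.decomp x = M.decomp y := DFinsupp.ext fun i => Subtype.ext (h i)
  exact M.decomp.injective hd

/-- Every element is a sum of homogeneous elements. -/
theorem induction_homogeneous (M : GrMod.{v} 𝒜) {p : M → Prop} (h0 : p 0)
    (hadd : ∀ x y, p x → p y → p (x + y)) (h : ∀ i, ∀ x ∈ M.deg i, p x) (x : M) : p x := by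
  obtain ⟨s, -, hs⟩ := M.comp_sum x
  rw [hs]
  exact Finset.sum_induction _ p hadd h0 fun i _ => h i _ (M.comp_mem i x)

theorem comp_smul (M : GrMod.{v} 𝒜) {i : ℤ} {r : R} (hr : r ∈ 𝒜 i) (j : ℤ) (m : M) :
    M.comp (i + j) (r • m) = r • M.comp j m := by
  induction m using M.induction_homogeneous with
  | h0 => rw [smul_zero, comp_zero, comp_zero, smul_zero]
  | hadd x y hx hy => rw [smul_add, comp_add, hx, hy, comp_add, smul_add]
  | h a x hx =>
    by_cases haj : a = j
    · subst haj
      rw [M.comp_self _ _ hx, M.comp_self _ _ (M.smul_mem' hr hx)]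
    · rw [M.comp_ne _ _ _ (Ne.symm haj) hx, smul_zero,
        M.comp_ne _ _ _ (by omega) (M.smul_mem' hr hx)]

theorem eq_zero_of_mem_of_mem (M : GrMod.{v} 𝒜) {i j : ℤ} (hij : i ≠ j) {x : M}
    (hi : x ∈ M.deg i) (hj : x ∈ M.deg j) : x = 0 := by
  rw [← M.comp_self i x hi, M.comp_ne i j x hij hj]

section Morphisms

variable {M N P : GrMod.{v} 𝒜}

theorem mono_of_injective (f : M ⟶ N) (hf : Function.Injective (lin f)) : Mono f :=
  ⟨fun _ _ hgh => hom_ext' (LinearMap.ext fun x =>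
    hf (LinearMap.congr_fun (congrArg lin hgh) x))⟩

theorem epi_of_surjective (f : M ⟶ N) (hf : Function.Surjective (lin f)) : Epi f :=
  ⟨fun _ _ hgh => hom_ext' (LinearMap.ext fun x => by
    obtain ⟨y, rfl⟩ := hf x
    exact LinearMap.congr_fun (congrArg lin hgh) y)⟩

theorem shortExact_of_lin (f : M ⟶ N) (g : N ⟶ P) (hf : Function.Injective (lin f))
    (hg : Function.Surjective (lin g)) (w : f ≫ g = 0)
    (h : ∀ x, lin g x = 0 → ∃ y, lin f y = x) : (ShortComplex.mk f g w).ShortExact := by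
  have := mono_of_injective f hf
  have := epi_of_surjective g hg
  have hlim : IsLimit (KernelFork.ofι f w) := KernelFork.IsLimit.ofι' f w fun {W} k hk =>
    KernelFork.IsLimit.lift' (monoIsLimit f) k (hom_ext' (LinearMap.ext fun x =>
      (Submodule.Quotient.mk_eq_zero _).2
        (h (lin k x) (LinearMap.congr_fun (congrArg lin hk) x))))
  exact ⟨ShortComplex.exact_of_f_is_kernel _ hlim⟩

theorem isZero_of_forall_eq_zero (h : ∀ x : M, x = 0) : IsZero M :=
  (IsZero.iff_id_eq_zero M).2 (hom_ext' (LinearMap.ext h))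

/-- The shift of a morphism of graded modules. -/
def shiftMap (f : M ⟶ N) (n : ℤ) : M.shift n ⟶ N.shift n :=
  homMk (M := M.shift n) (N := N.shift n) (lin f :) fun _ _ h => lin_mem f h

/-- A morphism from a shift, as a morphism into a shift. -/
def unshiftLeft {n : ℤ} (f : M.shift n ⟶ N) : M ⟶ N.shift (-n) :=
  homMk (M := M) (N := N.shift (-n)) (lin f :) fun i m h => by
    have h' : m ∈ (M.shift n).deg (i + -n) := by
      change m ∈ M.deg _
      simpa using h
    exact lin_mem f h'

/-- Shifting is invertible, so the lifting problem is moved to M by shifting its target by -n. -/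
instance projective_shift [Projective M] (n : ℤ) : Projective (M.shift n) where
  factors {X Y} f e _ := by
    have : Epi (shiftMap e (-n)) := epi_of_surjective _ (surjective_of_epi e :)
    let h : M ⟶ X.shift (-n) := Projective.factorThru (unshiftLeft f) (shiftMap e (-n))
    have hh : h ≫ shiftMap e (-n) = unshiftLeft f := Projective.factorThru_comp _ _
    refine ⟨homMk (M := M.shift n) (N := X) (lin h :) fun i m hm => ?_,
      hom_ext' (LinearMap.ext fun x => LinearMap.congr_fun (congrArg lin hh) x)⟩
    have := lin_mem h (i := i + n) hm
    exact (add_neg_cancel_right i n) ▸ this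

end Morphisms

section Free

variable [GradedAlgebra 𝒜] {ι : Type v} [Fintype ι]

/-- The graded free module with a basis indexed by `ι`, the `i`-th basis vector being of
degree `d i`. -/
def free (𝒜 : ℤ → Submodule K R) [GradedAlgebra 𝒜] (ι : Type v) [Fintype ι] (d : ι → ℤ) :
    GrMod.{max u v} 𝒜 where
  carrier := ι → R
  deg j := AddSubgroup.pi Set.univ fun i => (𝒜 (j - d i)).toAddSubgroup
  isInternal := by
    classical
    let A := regularGrMod 𝒜
    refine isInternal_of_projections _ (fun j x i => A.comp (j - d i) (x i)) ?_ ?_ ?_ ?_ ?_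
    · exact fun j x y => funext fun i => A.comp_add _ _ _
    · exact fun j x h => funext fun i => A.comp_self _ _ (h i trivial)
    · exact fun j l x hjl h => funext fun i =>
        A.comp_ne _ (l - d i) _ (by omega) (h i trivial)
    · exact fun j x i _ => A.comp_mem _ _
    · intro x
      choose s h0 hs using fun i => A.comp_sum (x i)
      let t : Finset ℤ := Finset.univ.biUnion fun i => (s i).image (· + d i)
      have ht : ∀ i, ∀ j ∉ t, A.comp (j - d i) (x i) = 0 := fun i j hj => h0 i _ fun hj' =>
        hj (Finset.mem_biUnion.2 ⟨i, Finset.mem_univ _, Finset.mem_image.2 ⟨_, hj', by simp⟩⟩)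
      refine ⟨t, fun j hj => funext fun i => ht i j hj, funext fun i => ?_⟩
      refine Eq.trans ?_ (Finset.sum_apply i t fun j i => A.comp (j - d i) (x i)).symm
      have hinj : Function.Injective fun a : ℤ => a + d i := add_left_injective _
      have h1 : ∑ j ∈ (s i).image (· + d i), A.comp (j - d i) (x i) =
          ∑ a ∈ s i, A.comp a (x i) := by
        rw [Finset.sum_image fun a _ b _ hab => hinj hab]
        simp
      exact ((hs i).trans h1.symm).trans <| Finset.sum_subset
          (Finset.subset_biUnion_of_mem (fun i => (s i).image (· + d i)) (Finset.mem_univ i))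
          fun j _ hj => h0 i _ fun hj' => hj (Finset.mem_image.2 ⟨_, hj', by simp⟩)
  smul_mem' {i j r m} hr hm l _ := by
    have := SetLike.GradedMul.mul_mem hr (hm l trivial)
    rwa [← add_sub_assoc] at this

theorem mem_free_deg {d : ι → ℤ} {j : ℤ} {x : ι → R} :
    x ∈ (free 𝒜 ι d).deg j ↔ ∀ i, x i ∈ 𝒜 (j - d i) :=
  ⟨fun h i => h i trivial, fun h i _ => h i⟩

/-- The basis vectors of a graded free module. -/
def free.basis (𝒜 : ℤ → Submodule K R) [GradedAlgebra 𝒜] {ι : Type v} [Fintype ι] [DecidableEq ι]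
    (d : ι → ℤ) (i : ι) : free 𝒜 ι d := (Pi.single i 1 : ι → R)

theorem free.basis_mem [DecidableEq ι] (d : ι → ℤ) (i : ι) :
    free.basis 𝒜 d i ∈ (free 𝒜 ι d).deg (d i) := by
  refine mem_free_deg.2 fun l => ?_
  by_cases h : l = i
  · subst h
    simpa [free.basis] using SetLike.GradedOne.one_mem (A := 𝒜)
  · simp [free.basis, h]

theorem free.sum_basis [DecidableEq ι] (d : ι → ℤ) (x : ι → R) :
    (x : free 𝒜 ι d) = ∑ i, x i • free.basis 𝒜 d i := by
  funext j
  refine Eq.trans ?_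
    (Finset.sum_apply j Finset.univ fun i => x i • (Pi.single i (1 : R) : ι → R)).symm
  simp [Pi.single_apply]

/-- The morphism from a graded free module determined by the images of the basis vectors. -/
def free.lift {M : GrMod.{max u v} 𝒜} (d : ι → ℤ) (m : ι → M) (hm : ∀ i, m i ∈ M.deg (d i)) :
    free 𝒜 ι d ⟶ M :=
  homMk (M := free 𝒜 ι d) (Fintype.linearCombination R m) fun j x hx => by
    change ∑ i, x i • m i ∈ M.deg j
    refine sum_mem fun i _ => ?_
    have := M.smul_mem' (mem_free_deg.1 hx i) (hm i)
    simpa using this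

theorem free.lift_apply {M : GrMod.{max u v} 𝒜} (d : ι → ℤ) (m : ι → M)
    (hm : ∀ i, m i ∈ M.deg (d i)) (x : ι → R) :
    lin (free.lift d m hm) x = ∑ i, x i • m i := rfl

instance free.projective (d : ι → ℤ) : Projective (free 𝒜 ι d) where
  factors {X Y} f e _ := by
    classical
    choose y hy using fun i => surjective_of_epi e (lin f (free.basis 𝒜 d i))
    -- The chosen preimages need not be homogeneous; their components of degree `d i` are again
    -- preimages, because the images of the basis vectors are homogeneous.
    refine ⟨free.lift d (fun i => X.comp (d i) (y i)) fun i => X.comp_mem _ _,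
      hom_ext' (LinearMap.ext fun (x : ι → R) => ?_)⟩
    change lin e (lin (free.lift d _ _) x) = lin f x
    rw [free.lift_apply, map_sum]
    conv_rhs => rw [free.sum_basis (𝒜 := 𝒜) d x]
    rw [map_sum]
    refine Finset.sum_congr rfl fun i _ => ?_
    rw [map_smul, map_smul, ← comp_lin, hy,
      Y.comp_self _ _ (lin_mem f (free.basis_mem d i))]

end Free

end GrMod

/-! ### The graded dual over a base field -/

/-- The field `k` acts on the graded ring `R` through elements of degree zero. -/
class BaseDegreeZero (k : Type*) {K R : Type*} [Field k] [Field K] [Ring R] [Algebra k R]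
    [Algebra K R] (𝒜 : ℤ → Submodule K R) : Prop where
  algebraMap_mem : ∀ c : k, algebraMap k R c ∈ 𝒜 0

/-- Degree-preserving anti-homomorphisms of graded `k`-algebras from `S` to `R`. -/
structure GradedAntiHom (k : Type*) {K R S : Type*} [Field k] [Field K] [Ring R] [Ring S]
    [Algebra k R] [Algebra k S] [Algebra K R] [Algebra K S]
    (𝒜 : ℤ → Submodule K R) (ℬ : ℤ → Submodule K S) where
  toFun : S → R
  map_one : toFun 1 = 1
  map_zero : toFun 0 = 0
  map_add : ∀ x y, toFun (x + y) = toFun x + toFun y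
  map_mul : ∀ x y, toFun (x * y) = toFun y * toFun x
  map_algebraMap : ∀ c : k, toFun (algebraMap k S c) = algebraMap k R c
  map_mem : ∀ {i : ℤ} {s : S}, s ∈ ℬ i → toFun s ∈ 𝒜 i

namespace GrMod

variable {K : Type w} {R S : Type u} {k : Type v} [Field K] [Field k] [Ring R] [Algebra K R]
  [Algebra k R] {𝒜 : ℤ → Submodule K R} [Ring S] [Algebra K S] [Algebra k S]
  {ℬ : ℤ → Submodule K S}

/-- The vector space structure on a graded module. -/
@[reducible] def baseModule (k : Type v) [Field k] [Algebra k R] (M : GrMod.{v} 𝒜) : Module k M :=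
  Module.compHom M (algebraMap k R)

attribute [local instance 50] baseModule

theorem base_smul (M : GrMod.{v} 𝒜) (c : k) (m : M) : c • m = algebraMap k R c • m := rfl

instance (M : GrMod.{v} 𝒜) : IsScalarTower k R M where
  smul_assoc c r m := by rw [base_smul, Algebra.smul_def, mul_smul]

instance (M : GrMod.{v} 𝒜) : SMulCommClass R k M where
  smul_comm r c m := by
    rw [base_smul, base_smul, ← mul_smul, ← mul_smul, Algebra.commutes]

/-- A linear map of graded modules as a map of vector spaces. -/
def baseLin (k : Type v) [Field k] [Algebra k R] {M N : GrMod.{v} 𝒜} (f : M →ₗ[R] N) :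
    M →ₗ[k] N where
  toFun := f
  map_add' := f.map_add
  map_smul' c m := f.map_smul (algebraMap k R c) m

/-- The action of a ring element on a graded module as a map of vector spaces. -/
def act (k : Type v) [Field k] [Algebra k R] (M : GrMod.{v} 𝒜) (r : R) : M →ₗ[k] M where
  toFun m := r • m
  map_add' := smul_add r
  map_smul' c m := smul_comm r c m

section Base

variable [BaseDegreeZero k 𝒜]

/-- The projection to a homogeneous component as a map of vector spaces. -/
noncomputable def compLin (k : Type v) [Field k] [Algebra k R] [BaseDegreeZero k 𝒜]
    (M : GrMod.{v} 𝒜) (i : ℤ) : M →ₗ[k] M where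
  toFun := M.comp i
  map_add' := M.comp_add i
  map_smul' c m := by
    have := M.comp_smul (BaseDegreeZero.algebraMap_mem (𝒜 := 𝒜) c) i m
    rwa [zero_add] at this

/-- The finitely supported functionals on a graded module. -/
def finFunctional (k : Type v) [Field k] [Algebra k R] (M : GrMod.{v} 𝒜) :
    AddSubgroup (M →ₗ[k] k) where
  -- Finite support makes the dual a direct sum, not a product, of its homogeneous parts.
  carrier := {φ | ∃ s : Finset ℤ, ∀ i ∉ s, ∀ m ∈ M.deg i, φ m = 0}
  zero_mem' := ⟨∅, fun _ _ _ _ => rfl⟩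
  add_mem' := by
    classical
    rintro φ ψ ⟨s, hs⟩ ⟨t, ht⟩
    refine ⟨s ∪ t, fun i hi m hm => ?_⟩
    rw [Finset.notMem_union] at hi
    rw [LinearMap.add_apply, hs i hi.1 m hm, ht i hi.2 m hm, add_zero]
  neg_mem' := by
    rintro φ ⟨s, hs⟩
    exact ⟨s, fun i hi m hm => by rw [LinearMap.neg_apply, hs i hi m hm, neg_zero]⟩

omit [BaseDegreeZero k 𝒜] in
theorem comp_act_mem_finFunctional [GradedAlgebra 𝒜] (M : GrMod.{v} 𝒜) (r : R)
    {φ : M →ₗ[k] k} (hφ : φ ∈ M.finFunctional k) : φ ∘ₗ M.act k r ∈ M.finFunctional k := by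
  classical
  obtain ⟨s, hs⟩ := hφ
  obtain ⟨t, -, ht⟩ := (regularGrMod 𝒜).comp_sum r
  -- A component of `r` of degree a moves degree i to a + i, so only degrees i in s - t can
  -- contribute.
  refine ⟨(s ×ˢ t).image fun p => p.1 - p.2, fun i hi m hm => ?_⟩
  let c : ℤ → R := fun a => (regularGrMod 𝒜).comp a r
  have h1 : r • m = ∑ a ∈ t, c a • m := by
    rw [← Finset.sum_smul]
    exact congrArg (fun x : R => x • m) ht
  change φ (r • m) = 0
  rw [h1, map_sum]
  refine Finset.sum_eq_zero fun a ha => hs (a + i) (fun h => hi ?_) _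
    (M.smul_mem' ((regularGrMod 𝒜).comp_mem a r) hm)
  exact Finset.mem_image.2 ⟨(a + i, a), Finset.mem_product.2 ⟨h, ha⟩, by simp⟩

/-- A functional on a homogeneous submodule, supported in one degree, extends. -/
theorem exists_extend_functional {M N : GrMod.{v} 𝒜} (f : M ⟶ N)
    (hf : Function.Injective (lin f)) (j : ℤ) (φ : M →ₗ[k] k)
    (h : ∀ i, i + j ≠ 0 → ∀ m ∈ M.deg i, φ m = 0) :
    ∃ ψ : N →ₗ[k] k, (∀ m, ψ (lin f m) = φ m) ∧ ∀ i, i + j ≠ 0 → ∀ n ∈ N.deg i, ψ n = 0 := by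
  obtain ⟨g, hg⟩ := (baseLin k (lin f)).exists_leftInverse_of_injective
    (LinearMap.ker_eq_bot.2 hf)
  -- The retraction `g` ignores the grading; projecting to degree -j first restores the support
  -- condition.
  refine ⟨φ ∘ₗ g ∘ₗ N.compLin k (-j), fun m => ?_, fun i hi n hn => ?_⟩
  · change φ (g (N.comp (-j) (lin f m))) = φ m
    rw [comp_lin]
    have h1 : g (lin f (M.comp (-j) m)) = M.comp (-j) m := LinearMap.congr_fun hg _
    rw [h1]
    induction m using M.induction_homogeneous with
    | h0 => rw [comp_zero]
    | hadd x y hx hy =>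
      rw [comp_add, map_add, map_add, hx (LinearMap.congr_fun hg _),
        hy (LinearMap.congr_fun hg _)]
    | h i m hm =>
      by_cases hij : i = -j
      · rw [← hij, M.comp_self _ _ hm]
      · rw [M.comp_ne _ _ _ (Ne.symm hij) hm, map_zero, h i (by omega) m hm]
  · change φ (g (N.comp (-j) n)) = 0
    rw [N.comp_ne _ i n (by omega) hn, map_zero, map_zero]

variable [GradedAlgebra 𝒜] (σ : GradedAntiHom k 𝒜 ℬ)

/-- The action on functionals through an anti-homomorphism. -/
@[reducible] def dualModule (M : GrMod.{v} 𝒜) : Module S (M.finFunctional k) where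
  smul s φ := ⟨φ.1 ∘ₗ M.act k (σ.toFun s), comp_act_mem_finFunctional M _ φ.2⟩
  one_smul φ := Subtype.ext (LinearMap.ext fun m => by
    change φ.1 (σ.toFun 1 • m) = φ.1 m
    rw [σ.map_one, one_smul])
  mul_smul s t φ := Subtype.ext (LinearMap.ext fun m => by
    change φ.1 (σ.toFun (s * t) • m) = φ.1 (σ.toFun t • σ.toFun s • m)
    rw [σ.map_mul, mul_smul])
  smul_zero s := rfl
  smul_add s φ ψ := rfl
  add_smul s t φ := Subtype.ext (LinearMap.ext fun m => by
    change φ.1 (σ.toFun (s + t) • m) = φ.1 (σ.toFun s • m) + φ.1 (σ.toFun t • m)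
    rw [σ.map_add, add_smul, _root_.map_add])
  zero_smul φ := Subtype.ext (LinearMap.ext fun m => by
    change φ.1 (σ.toFun 0 • m) = 0
    rw [σ.map_zero, zero_smul, _root_.map_zero])

/-- The graded dual of a graded module. -/
def dual (M : GrMod.{v} 𝒜) : GrMod.{v} ℬ where
  carrier := M.finFunctional k
  module := dualModule σ M
  deg j :=
    -- The part of degree j is dual to the part of degree -j, the sign that lets scalars of degree i
    -- raise degrees by i.
    { carrier := {φ | ∀ i, i + j ≠ 0 → ∀ m ∈ M.deg i, φ.1 m = 0}
      zero_mem' := fun _ _ _ _ => rfl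
      add_mem' := fun {φ ψ} hφ hψ i hi m hm => by
        change φ.1 m + ψ.1 m = 0
        rw [hφ i hi m hm, hψ i hi m hm, add_zero]
      neg_mem' := fun {φ} hφ i hi m hm => by
        change -φ.1 m = 0
        rw [hφ i hi m hm, neg_zero] }
  isInternal := by
    classical
    have hfin : ∀ (j : ℤ) (φ : M →ₗ[k] k) (i : ℤ), i + j ≠ 0 → ∀ m ∈ M.deg i,
        (φ ∘ₗ M.compLin k (-j)) m = 0 := fun j φ i hi m hm => by
      change φ (M.comp (-j) m) = 0
      rw [M.comp_ne _ i m (by omega) hm, map_zero]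
    refine isInternal_of_projections _
      (fun j φ => ⟨φ.1 ∘ₗ M.compLin k (-j), {-j}, fun i hi => hfin j φ.1 i fun h =>
        hi (by rw [Finset.mem_singleton]; omega)⟩) ?_ ?_ ?_ ?_ ?_
    · exact fun j φ ψ => rfl
    · refine fun j φ hφ => Subtype.ext (LinearMap.ext fun m => ?_)
      change φ.1 (M.comp (-j) m) = φ.1 m
      induction m using M.induction_homogeneous with
      | h0 => rw [comp_zero]
      | hadd x y hx hy => rw [comp_add, map_add, map_add, hx, hy]
      | h i m hm =>
        by_cases hij : i = -j
        · rw [← hij, M.comp_self _ _ hm]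
        · rw [M.comp_ne _ _ _ (Ne.symm hij) hm, map_zero, hφ i (by omega) m hm]
    · refine fun j l φ hjl hφ => Subtype.ext (LinearMap.ext fun m => ?_)
      exact hφ (-j) (by omega) _ (M.comp_mem _ _)
    · exact fun j φ => hfin j φ.1
    · rintro ⟨φ, s, hs⟩
      refine ⟨s.map (Equiv.neg ℤ).toEmbedding, fun j hj => Subtype.ext (LinearMap.ext fun m => ?_),
        Subtype.ext (LinearMap.ext fun m => ?_)⟩
      · refine hs (-j) (fun h => hj ?_) _ (M.comp_mem _ _)
        rw [Finset.mem_map_equiv]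
        exact h
      · rw [AddSubgroup.val_finsetSum, LinearMap.sum_apply, Finset.sum_map]
        change φ m = ∑ i ∈ s, φ (M.comp (- -i) m)
        simp only [neg_neg]
        rw [← map_sum]
        induction m using M.induction_homogeneous with
        | h0 => simp [comp_zero]
        | hadd x y hx hy =>
          simp only [comp_add, Finset.sum_add_distrib]
          rw [map_add, map_add, hx, hy]
        | h i m hm =>
          by_cases hi : i ∈ s
          · rw [Finset.sum_eq_single_of_mem i hi fun j _ hj => M.comp_ne _ _ _ hj hm,
              M.comp_self _ _ hm]
          · rw [hs i hi m hm, Finset.sum_eq_zero, map_zero]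
            exact fun j hj => M.comp_ne _ _ _ (fun h => hi (by rwa [← h])) hm
  smul_mem' {i j s φ} hs hφ l hl m hm :=
    hφ (i + l) (by omega) _ (M.smul_mem' (σ.map_mem hs) hm)

/-- The functional underlying an element of the graded dual. -/
def functional {M : GrMod.{v} 𝒜} (φ : dual σ M) : M →ₗ[k] k := Subtype.val φ

variable {σ}

theorem dual_ext {M : GrMod.{v} 𝒜} {φ ψ : dual σ M}
    (h : ∀ m, functional σ φ m = functional σ ψ m) : φ = ψ :=
  Subtype.ext (LinearMap.ext h)

@[simp] theorem functional_smul {M : GrMod.{v} 𝒜} (s : S) (φ : dual σ M) (m : M) :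
    functional σ (s • φ) m = functional σ φ (σ.toFun s • m) := rfl

@[simp] theorem functional_add {M : GrMod.{v} 𝒜} (φ ψ : dual σ M) :
    functional σ (φ + ψ) = functional σ φ + functional σ ψ := rfl

@[simp] theorem functional_zero {M : GrMod.{v} 𝒜} :
    functional σ (0 : dual σ M) = 0 := rfl

theorem functional_comp {M : GrMod.{v} 𝒜} (φ : dual σ M) (j : ℤ) (m : M) :
    functional σ ((dual σ M).comp j φ) m = functional σ φ (M.comp (-j) m) := by
  induction φ using (dual σ M).induction_homogeneous with
  | h0 => rw [comp_zero]; rfl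
  | hadd x y hx hy =>
    rw [comp_add, functional_add, functional_add, LinearMap.add_apply, LinearMap.add_apply, hx, hy]
  | h i φ hφ =>
    by_cases hij : i = j
    · subst hij
      rw [(dual σ M).comp_self _ _ hφ]
      induction m using M.induction_homogeneous with
      | h0 => rw [comp_zero]
      | hadd x y hx hy => rw [comp_add, map_add, map_add, hx, hy]
      | h l m hm =>
        by_cases hl : l = -i
        · rw [← hl, M.comp_self _ _ hm]
        · rw [M.comp_ne _ _ _ (Ne.symm hl) hm, map_zero]
          exact hφ l (by omega) m hm
    · rw [(dual σ M).comp_ne _ _ _ (Ne.symm hij) hφ, functional_zero, LinearMap.zero_apply]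
      exact (hφ (-j) (by omega) _ (M.comp_mem _ _)).symm

/-- A functional supported in a single degree, as an element of the graded dual. -/
def dualMk (σ : GradedAntiHom k 𝒜 ℬ) {M : GrMod.{v} 𝒜} (j : ℤ) (φ : M →ₗ[k] k)
    (h : ∀ i, i + j ≠ 0 → ∀ m ∈ M.deg i, φ m = 0) : dual σ M :=
  ⟨φ, {-j}, fun i hi => h i fun h => hi (by rw [Finset.mem_singleton]; omega)⟩

/-- The homomorphism to a graded dual determined by a balanced pairing, homogeneous of some
degree. -/
def pairLin (σ : GradedAntiHom k 𝒜 ℬ) {M : GrMod.{v} 𝒜} {N : GrMod.{v} ℬ} (c : ℤ)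
    (β : N → M →ₗ[k] k) (hadd : ∀ x y, β (x + y) = β x + β y)
    (hsmul : ∀ s x m, β (s • x) m = β x (σ.toFun s • m))
    (hdeg : ∀ a b, b + (a + c) ≠ 0 → ∀ x ∈ N.deg a, ∀ m ∈ M.deg b, β x m = 0) :
    N →ₗ[S] dual σ M where
  toFun x := ⟨β x, by
    let β' : N →+ (M →ₗ[k] k) := AddMonoidHom.mk' β hadd
    change β' x ∈ M.finFunctional k
    induction x using N.induction_homogeneous with
    | h0 => rw [map_zero]; exact zero_mem _
    | hadd x y hx hy => rw [_root_.map_add]; exact add_mem hx hy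
    | h a x hx => exact (dualMk σ (a + c) (β x) fun b hb m hm => hdeg a b hb x hx m hm).2⟩
  map_add' x y := Subtype.ext (hadd x y)
  map_smul' s x := Subtype.ext (LinearMap.ext (hsmul s x))

theorem pairLin_mem {M : GrMod.{v} 𝒜} {N : GrMod.{v} ℬ} (c : ℤ)
    (β : N → M →ₗ[k] k) (hadd : ∀ x y, β (x + y) = β x + β y)
    (hsmul : ∀ s x m, β (s • x) m = β x (σ.toFun s • m))
    (hdeg : ∀ a b, b + (a + c) ≠ 0 → ∀ x ∈ N.deg a, ∀ m ∈ M.deg b, β x m = 0)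
    {a : ℤ} {x : N} (hx : x ∈ N.deg a) :
    pairLin σ c β hadd hsmul hdeg x ∈ (dual σ M).deg (a + c) :=
  fun b hb m hm => hdeg a b hb x hx m hm

variable (σ) in
/-- The graded dual of a morphism. -/
def dualMap {M N : GrMod.{v} 𝒜} (f : M ⟶ N) : dual σ N ⟶ dual σ M :=
  homMk (M := dual σ N) (N := dual σ M)
    (pairLin σ 0 (fun φ => functional σ φ ∘ₗ baseLin k (lin f)) (fun _ _ => rfl)
      (fun s φ m => by
        change functional σ φ (σ.toFun s • lin f m) = functional σ φ (lin f (σ.toFun s • m))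
        rw [(lin f).map_smul])
      (fun a b hab φ hφ m hm => hφ b (by omega) _ (lin_mem f hm)))
    (fun i φ hφ => by
      have := pairLin_mem (σ := σ) (M := M) (N := dual σ N) 0
        (fun φ => functional σ φ ∘ₗ baseLin k (lin f)) (fun _ _ => rfl)
        (fun s φ m => by
          change functional σ φ (σ.toFun s • lin f m) = functional σ φ (lin f (σ.toFun s • m))
          rw [(lin f).map_smul])
        (fun a b hab φ hφ m hm => hφ b (by omega) _ (lin_mem f hm)) hφ
      rwa [add_zero] at this)

/-- Over a field functionals extend from subspaces; this is done one degree at a time to stay in the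
graded dual. -/
theorem dualMap_surjective {M N : GrMod.{v} 𝒜} (f : M ⟶ N) (hf : Function.Injective (lin f)) :
    Function.Surjective (lin (dualMap σ f)) := by
  intro φ
  induction φ using (dual σ M).induction_homogeneous with
  | h0 => exact ⟨0, map_zero _⟩
  | hadd x y hx hy =>
    obtain ⟨a, rfl⟩ := hx
    obtain ⟨b, rfl⟩ := hy
    exact ⟨a + b, map_add _ _ _⟩
  | h j φ hφ =>
    obtain ⟨ψ, h1, h2⟩ := exists_extend_functional f hf j (functional σ φ) hφ
    exact ⟨dualMk σ j ψ h2, dual_ext h1⟩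

variable [GradedAlgebra ℬ] [BaseDegreeZero k ℬ]

/-- Morphisms `N ⟶ D M` are morphisms `M ⟶ D N`. -/
def transpose (τ : GradedAntiHom k ℬ 𝒜) (h : ∀ r, σ.toFun (τ.toFun r) = r) {M : GrMod.{v} 𝒜}
    {N : GrMod.{v} ℬ} (g : N ⟶ dual σ M) : M ⟶ dual τ N :=
  let β : M → N →ₗ[k] k := fun m =>
    { toFun n := functional σ (lin g n) m
      map_add' x y := by rw [map_add]; rfl
      map_smul' c x := by
        rw [base_smul, map_smul, functional_smul, σ.map_algebraMap, ← base_smul, map_smul]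
        rfl }
  have hadd : ∀ x y, β (x + y) = β x + β y := fun x y => LinearMap.ext fun n =>
    map_add (functional σ (lin g n)) x y
  have hsmul : ∀ r x n, β (r • x) n = β x (τ.toFun r • n) := fun r x n => by
    change functional σ (lin g n) (r • x) = functional σ (lin g (τ.toFun r • n)) x
    rw [(lin g).map_smul, functional_smul, h]
  have hdeg : ∀ a b, b + (a + 0) ≠ 0 → ∀ x ∈ M.deg a, ∀ n ∈ N.deg b, β x n = 0 :=
    fun a b hab x hx n hn => lin_mem g hn a (by omega) x hx
  homMk (M := M) (N := dual τ N) (pairLin τ 0 β hadd hsmul hdeg) fun i x hx => by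
    have := pairLin_mem (σ := τ) 0 β hadd hsmul hdeg hx
    rwa [add_zero] at this

theorem functional_transpose (τ : GradedAntiHom k ℬ 𝒜) (h : ∀ r, σ.toFun (τ.toFun r) = r)
    {M : GrMod.{v} 𝒜} {N : GrMod.{v} ℬ} (g : N ⟶ dual σ M) (m : M) (n : N) :
    functional τ (lin (transpose τ h g) m) n = functional σ (lin g n) m := rfl

/-- The graded dual of a projective graded module is injective. -/
theorem injective_dual (τ : GradedAntiHom k ℬ 𝒜) (hστ : ∀ r, σ.toFun (τ.toFun r) = r)
    (hτσ : ∀ s, τ.toFun (σ.toFun s) = s) (P : GrMod.{v} 𝒜) [Projective P] :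
    Injective (dual σ P) where
  factors {W W'} g f _ := by
    -- Transposition turns extending `g` along `f` into lifting a map from `P` along the epimorphism
    -- D f.
    have : Epi (dualMap τ f) :=
      epi_of_surjective _ (dualMap_surjective f (injective_of_mono f))
    let h := Projective.factorThru (transpose τ hστ g) (dualMap τ f)
    have hh : h ≫ dualMap τ f = transpose τ hστ g := Projective.factorThru_comp _ _
    refine ⟨transpose σ hτσ h, hom_ext' (LinearMap.ext fun w => dual_ext fun p => ?_)⟩
    exact congrArg (fun q => functional τ (lin q p) w) hh

end Base

end GrMod

/-! ### Vanishing of Ext¹ in an abelian category -/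

section ExtLemmas

open Abelian

variable {C : Type u} [Category.{v} C] [Abelian C] [HasExt.{w} C]

/-- Vanishing of `Ext¹(-, Y)` passes to subobjects if `Y` has injective dimension at most one. -/
theorem subsingleton_ext_one_of_mono {X E Y : C} [HasInjectiveDimensionLT Y 2] (f : X ⟶ E)
    [Mono f] (hE : Subsingleton (Ext E Y 1)) : Subsingleton (Ext X Y 1) := by
  have hS : (ShortComplex.mk f (cokernel.π f) (cokernel.condition f)).ShortExact :=
    ⟨ShortComplex.exact_cokernel f⟩
  refine subsingleton_of_forall_eq 0 fun x => ?_
  -- The obstruction to extending a class from X to E lies in Ext² of the cokernel, which vanishes.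
  obtain ⟨y, rfl⟩ := Ext.contravariant_sequence_exact₁ hS (Y := Y) x (n₁ := 2) rfl
    (Ext.eq_zero_of_hasInjectiveDimensionLT _ 2 le_rfl)
  rw [hE.elim y 0, Ext.comp_zero]

/-- X is an extension of the image of `q`, a subobject of E, by the kernel of `q`. This drives the
induction on dimension. -/
theorem subsingleton_ext_one_of_hom {X E Y : C} [HasInjectiveDimensionLT Y 2] (q : X ⟶ E)
    (hE : Subsingleton (Ext E Y 1)) (hk : Subsingleton (Ext (kernel q) Y 1)) :
    Subsingleton (Ext X Y 1) := by
  have hI := subsingleton_ext_one_of_mono (Y := Y) (Limits.image.ι q) hE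
  have hq : kernel.ι q ≫ Limits.factorThruImage q = 0 := by
    rw [← cancel_mono (Limits.image.ι q), Category.assoc, Limits.image.fac, kernel.condition,
      zero_comp]
  have hlim : IsLimit (KernelFork.ofι (kernel.ι q) hq) :=
    KernelFork.IsLimit.ofι' _ _ fun k hk => ⟨kernel.lift q k (by
      rw [← Limits.image.fac q, ← Category.assoc, hk, zero_comp]), kernel.lift_ι _ _ _⟩
  have hS : (ShortComplex.mk _ _ hq).ShortExact := ⟨ShortComplex.exact_of_f_is_kernel _ hlim⟩
  refine subsingleton_of_forall_eq 0 fun x => ?_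
  obtain ⟨y, rfl⟩ := Ext.contravariant_sequence_exact₂ hS (Y := Y) x (hk.elim _ _)
  rw [hI.elim y 0, Ext.comp_zero]

/-- With a projective middle term, Ext¹ of the quotient is itself a quotient of Hom from the
subobject. -/
theorem subsingleton_ext_one_of_shortExact {S : ShortComplex C} (hS : S.ShortExact) {Y : C}
    [Projective S.X₂] (h : ∀ f : S.X₁ ⟶ Y, f = 0) : Subsingleton (Ext S.X₃ Y 1) := by
  refine subsingleton_of_forall_eq 0 fun x => ?_
  obtain ⟨y, rfl⟩ := Ext.contravariant_sequence_exact₃ hS (Y := Y) x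
    (Ext.eq_zero_of_projective _) (n₀ := 0) rfl
  obtain ⟨f, rfl⟩ := Ext.addEquiv₀.symm.surjective y
  rw [h f, map_zero, Ext.comp_zero]

end ExtLemmas

/-! ### Simple submodules and the kernel of a free cover of DS -/

/-- In a module over an artinian ring, every nonzero cyclic submodule contains a simple cyclic
submodule. -/
theorem exists_simple_generator {S : Type*} [Ring S] [IsArtinianRing S] {M : Type*}
    [AddCommGroup M] [Module S M] {c : M} (hc : c ≠ 0) :
    ∃ r : S, r • c ≠ 0 ∧ ∀ s : S, s • r • c ≠ 0 → ∃ t : S, t • s • r • c = r • c := by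
  let N : Submodule S S := LinearMap.ker (LinearMap.toSpanSingleton S M c)
  have hN : ∀ r : S, r ∈ N ↔ r • c = 0 := fun r => by
    rw [LinearMap.mem_ker, LinearMap.toSpanSingleton_apply]
  have hne : ({I | N < I} : Set (Submodule S S)).Nonempty :=
    ⟨⊤, lt_top_iff_ne_top.2 fun h : N = ⊤ => hc (by
      have : (1 : S) ∈ N := by rw [h]; exact Submodule.mem_top
      rwa [hN, one_smul] at this)⟩
  -- With I minimal among left ideals strictly above the annihilator N of `c`, the quotient I/N is
  -- simple, so any r in I outside N works.
  obtain ⟨I, hI, hmin⟩ := (wellFounded_lt (α := Submodule S S)).has_min _ hne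
  replace hI : N < I := hI
  obtain ⟨r, hrI, hr⟩ := SetLike.exists_of_lt hI
  refine ⟨r, fun h => hr ((hN r).2 h), fun s hs => ?_⟩
  have hJ : N < N ⊔ Submodule.span S {s * r} := by
    refine lt_of_le_of_ne le_sup_left fun h => hs ?_
    have : s * r ∈ N := h ▸ Submodule.mem_sup_right (Submodule.mem_span_singleton_self _)
    rwa [hN, mul_smul] at this
  have hJI : N ⊔ Submodule.span S {s * r} ≤ I := sup_le hI.le
    ((Submodule.span_singleton_le_iff_mem _ _).2 (I.smul_mem s hrI))
  have hr' : r ∈ N ⊔ Submodule.span S {s * r} := by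
    by_contra h
    exact hmin _ hJ (lt_of_le_of_ne hJI fun h' => h (h' ▸ hrI))
  obtain ⟨a, ha, b, hb, hab⟩ := Submodule.mem_sup.1 hr'
  obtain ⟨t, rfl⟩ := Submodule.mem_span_singleton.1 hb
  refine ⟨t, ?_⟩
  conv_rhs => rw [← hab, add_smul, (hN a).1 ha, zero_add, smul_eq_mul, mul_smul, mul_smul]

namespace GrMod

variable {K : Type w} {R S k : Type u} [Field K] [Field k] [Ring R] [Algebra K R]
  [Algebra k R] {𝒜 : ℤ → Submodule K R} [Ring S] [Algebra K S] [Algebra k S]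
  {ℬ : ℤ → Submodule K S} [GradedAlgebra 𝒜] [GradedAlgebra ℬ]
  [BaseDegreeZero k 𝒜] [BaseDegreeZero k ℬ] {σ : GradedAntiHom k 𝒜 ℬ} {τ : GradedAntiHom k ℬ 𝒜}

attribute [local instance 50] baseModule

omit [GradedAlgebra 𝒜] in
theorem eq_zero_of_mem_neg [IsNonnegGraded 𝒜] {i : ℤ} (hi : i < 0) {x : R} (hx : x ∈ 𝒜 i) :
    x = 0 := by
  rwa [IsNonnegGraded.eq_bot_of_neg (𝒜 := 𝒜) i hi, Submodule.mem_bot] at hx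

-- A functional of degree j sees only the part of degree -j, and the ring has nothing in negative
-- degrees.
omit [GradedAlgebra ℬ] [BaseDegreeZero k ℬ] in
theorem dual_regular_eq_zero [IsNonnegGraded 𝒜] {j : ℤ} (hj : 0 < j)
    {φ : dual σ (regularGrMod 𝒜)} (hφ : φ ∈ (dual σ (regularGrMod 𝒜)).deg j) : φ = 0 := by
  refine dual_ext fun m => ?_
  induction m using (regularGrMod 𝒜).induction_homogeneous with
  | h0 => rw [map_zero, map_zero]
  | hadd x y hx hy => rw [map_add, map_add, hx, hy]
  | h i m hm =>
    by_cases hij : i + j = 0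
    · have h0 : m = 0 := eq_zero_of_mem_neg (𝒜 := 𝒜) (by omega : i < 0) hm
      rw [h0, map_zero, map_zero]
    · exact hφ i hij m hm

omit [GradedAlgebra ℬ] [BaseDegreeZero k ℬ] in
/-- Homogeneous functionals separate the elements of a graded module. -/
theorem eq_zero_of_forall_functional (σ : GradedAntiHom k 𝒜 ℬ) {M : GrMod.{u} 𝒜} {m : M}
    (h : ∀ φ : dual σ M, functional σ φ m = 0) : m = 0 := by
  refine M.ext_comp fun i => ?_
  rw [comp_zero]
  refine (Module.forall_dual_apply_eq_zero_iff k _).1 fun φ => ?_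
  exact h (dualMk σ (-i) (φ ∘ₗ M.compLin k i) fun l hl m hm => by
    change φ (M.comp i m) = 0
    rw [M.comp_ne i l m (by omega) hm, map_zero])

/-- The inclusion of the graded dual into the dual vector space. -/
def functionalLin (σ : GradedAntiHom k 𝒜 ℬ) (M : GrMod.{u} 𝒜) :
    dual σ M →ₗ[k] Module.Dual k M where
  toFun := functional σ
  map_add' _ _ := rfl
  map_smul' c φ := LinearMap.ext fun m => by
    rw [base_smul, functional_smul, σ.map_algebraMap, ← base_smul, map_smul]
    rfl

omit [GradedAlgebra ℬ] [BaseDegreeZero k ℬ] in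
theorem functionalLin_injective (M : GrMod.{u} 𝒜) : Function.Injective (functionalLin σ M) :=
  fun _ _ h => dual_ext fun m => LinearMap.congr_fun h m

omit [BaseDegreeZero k 𝒜] in
theorem finite_regular [Module.Finite k R] : Module.Finite k (regularGrMod 𝒜) :=
  haveI : Module.Finite R (regularGrMod 𝒜) := inferInstanceAs (Module.Finite R R)
  Module.Finite.trans R _

omit [BaseDegreeZero k 𝒜] in
/-- A finite-dimensional graded module is a quotient of a graded free module with basis vectors in
degrees in which the module is nonzero. -/
theorem exists_free_cover (M : GrMod.{u} 𝒜) [Module.Finite k M] :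
    ∃ (ι : Type) (_ : Fintype ι) (d : ι → ℤ) (p : free 𝒜 ι d ⟶ M),
      Function.Surjective (lin p) ∧ ∀ i, ∃ m ∈ M.deg (d i), m ≠ 0 := by
  classical
  let b := Module.finBasis k M
  choose s h0 hs using fun i => M.comp_sum (b i)
  let t : Finset ℤ := Finset.univ.biUnion s
  -- Zero components are discarded so that every basis vector has a degree occurring in M.
  let ι : Type := {a : Fin (Module.finrank k M) × t // M.comp a.2 (b a.1) ≠ 0}
  let p := free.lift (𝒜 := 𝒜) (M := M) (ι := ι) (fun a => a.1.2) (fun a => M.comp a.1.2 (b a.1.1))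
    fun a => M.comp_mem _ _
  have hgen : ∀ i : ι, M.comp i.1.2 (b i.1.1) ∈ LinearMap.range (lin p) := fun i => by
    refine ⟨free.basis 𝒜 _ i, ?_⟩
    change lin p (Pi.single i 1 : ι → R) = _
    rw [free.lift_apply, Finset.sum_eq_single i]
    · rw [Pi.single_eq_same, one_smul]
    · intro j _ hj
      rw [Pi.single_eq_of_ne hj, zero_smul]
    · exact fun h => absurd (Finset.mem_univ i) h
  refine ⟨ι, inferInstance, fun a => a.1.2, p, ?_, fun a => ⟨_, M.comp_mem _ _, a.2⟩⟩
  have hb : ∀ i, b i ∈ LinearMap.range (lin p) := fun i => by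
    rw [hs i]
    refine sum_mem fun j hj => ?_
    by_cases h : M.comp j (b i) = 0
    · rw [h]
      exact zero_mem _
    · exact hgen ⟨(i, ⟨j, Finset.mem_biUnion.2 ⟨i, Finset.mem_univ _, hj⟩⟩), h⟩
  intro m
  rw [← LinearMap.mem_range, ← b.sum_repr m]
  exact sum_mem fun i _ => Submodule.smul_mem _ (algebraMap k R _) (hb i)

/-- For a surjection `p : P → D S` from a projective module, the dual of its kernel is injective if
the regular module has injective dimension at most one. -/
theorem injective_dual_ker [Module.Finite k S] [HasInjectiveDimensionLE (regularGrMod ℬ) 1]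
    (hστ : ∀ r, σ.toFun (τ.toFun r) = r) (hτσ : ∀ s, τ.toFun (σ.toFun s) = s)
    {P : GrMod.{u} 𝒜} [Projective P] (p : P ⟶ dual τ (regularGrMod ℬ))
    (hp : Function.Surjective (lin p)) : Injective (dual σ (ker p)) := by
  have := finite_regular (k := k) (𝒜 := ℬ)
  -- This is the embedding S → DP, the dual of `p` composed with S → DDS; the aim is exactness of 0
  -- → S → DP → D(ker p) → 0.
  let j := transpose σ hτσ p
  have hj : ∀ s x, functional σ (lin j s) x = functional τ (lin p x) s :=
    fun s x => functional_transpose σ hτσ p s x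
  have hinj : Function.Injective (lin j) := by
    rw [← LinearMap.ker_eq_bot, eq_bot_iff]
    intro s hs
    refine eq_zero_of_forall_functional τ fun φ => ?_
    obtain ⟨x, rfl⟩ := hp φ
    rw [← hj, LinearMap.mem_ker.1 hs]
    rfl
  have hι : Function.Injective (lin (kerι p)) := Subtype.val_injective
  have hw : j ≫ dualMap σ (kerι p) = 0 := hom_ext' (LinearMap.ext fun s => dual_ext fun x => by
    change functional σ (lin j s) (lin (kerι p) x) = 0
    rw [hj]
    have : lin p (lin (kerι p) x) = 0 := LinearMap.congr_fun (congrArg lin (kerι_comp p)) x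
    rw [this]
    rfl)
  have hS := shortExact_of_lin j (dualMap σ (kerι p)) hinj (dualMap_surjective _ hι) hw ?_
  · have : Injective (dual σ P) := injective_dual τ hστ hτσ P
    have : HasInjectiveDimensionLT (dual σ (ker p)) 1 :=
      hS.hasInjectiveDimensionLT_X₃ 1 (inferInstanceAs (HasInjectiveDimensionLT (dual σ P) 1))
        (inferInstanceAs (HasInjectiveDimensionLE (regularGrMod ℬ) 1))
    exact injective_iff_hasInjectiveDimensionLT_one.2 this
  · intro φ hφ
    -- A functional vanishing on ker p factors through `p`. Extended from DS to the full linear dual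
    -- of S, it is evaluation at an element of S by finite-dimensionality.
    obtain ⟨g, hg⟩ := (baseLin k (lin p)).exists_rightInverse_of_surjective
      (LinearMap.range_eq_top.2 hp)
    obtain ⟨l, hl⟩ := (functionalLin τ (regularGrMod ℬ)).exists_leftInverse_of_injective
      (LinearMap.ker_eq_bot.2 (functionalLin_injective _))
    let Θ : Module.Dual k (Module.Dual k (regularGrMod ℬ)) := functional σ φ ∘ₗ g ∘ₗ l
    refine ⟨(Module.evalEquiv k (regularGrMod ℬ)).symm Θ, dual_ext fun x => ?_⟩
    rw [hj]
    have h1 : functional τ (lin p x) ((Module.evalEquiv k (regularGrMod ℬ)).symm Θ) =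
        Θ (functionalLin τ _ (lin p x)) :=
      Module.apply_evalEquiv_symm_apply k _ (functional τ (lin p x)) Θ
    rw [h1]
    change functional σ φ (g (l (functionalLin τ _ (lin p x)))) = functional σ φ x
    have h2 : l (functionalLin τ _ (lin p x)) = lin p x := LinearMap.congr_fun hl _
    have h3 : lin p (g (lin p x)) = lin p x := LinearMap.congr_fun hg (lin p x)
    have h4 : lin p (g (lin p x) - x) = 0 := by rw [map_sub, h3, sub_self]
    rw [h2, ← sub_eq_zero, ← map_sub]
    have h5 := congrArg (fun ψ => functional σ ψ (⟨g (lin p x) - x, h4⟩ : ker p)) hφ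
    exact h5

/-- Additive maps from a homogeneous part of positive degree to the part of degree zero that are
linear over the part of degree zero vanish. -/
def NoPositiveToZero (𝒜 : ℤ → Submodule K R) : Prop :=
  ∀ m : ℤ, 0 < m → ∀ θ : R →+ R, (∀ x ∈ 𝒜 m, θ x ∈ 𝒜 0) →
    (∀ b ∈ 𝒜 0, ∀ x ∈ 𝒜 m, θ (b * x) = b * θ x) → ∀ x ∈ 𝒜 m, θ x = 0

omit [GradedAlgebra 𝒜] [BaseDegreeZero k 𝒜] [BaseDegreeZero k ℬ] in
/-- If elements of positive degree annihilate a homogeneous element, then every ring element acts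
on it through its component of degree zero. -/
theorem smul_eq_comp_zero_smul [IsNonnegGraded ℬ] {M : GrMod.{v} ℬ} {c : M}
    (hc : ∀ d > 0, ∀ a ∈ ℬ d, a • c = 0) (s : S) :
    ∃ s₀ ∈ ℬ 0, s • c = s₀ • c := by
  refine (regularGrMod ℬ).induction_homogeneous (p := fun s : S => ∃ s₀ ∈ ℬ 0, s • c = s₀ • c)
    ⟨0, zero_mem _, rfl⟩ ?_ ?_ s
  · rintro x y ⟨a, ha, hx⟩ ⟨b, hb, hy⟩
    exact ⟨a + b, add_mem ha hb, by rw [add_smul, ← hx, ← hy]; exact add_smul (R := S) x y c⟩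
  · intro i x hx
    rcases lt_trichotomy i 0 with hi | rfl | hi
    · have h0 : x = 0 := eq_zero_of_mem_neg (𝒜 := ℬ) hi hx
      exact ⟨0, zero_mem _, by rw [h0]; rfl⟩
    · exact ⟨x, hx, rfl⟩
    · exact ⟨0, zero_mem _, (hc i hi x hx).trans (zero_smul _ _).symm⟩

/-- If the dual of the kernel of a free cover of `D S`, with basis vectors of nonpositive degrees,
is injective, then a morphism to it from a shift of `D R` by a positive number kills the lowest
functionals. -/
theorem map_dual_regular_eq_zero [Module.Finite k R] [IsNonnegGraded ℬ]
    (hστ : ∀ r, σ.toFun (τ.toFun r) = r) (h0 : NoPositiveToZero 𝒜)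
    {ι : Type} [Fintype ι] {d : ι → ℤ} (hd : ∀ i, d i ≤ 0)
    (p : free 𝒜 ι d ⟶ dual τ (regularGrMod ℬ)) {j : ℤ} (hj : 0 < j)
    (φ : (dual σ (regularGrMod 𝒜)).shift j ⟶ dual σ (ker p))
    {ψ : dual σ (regularGrMod 𝒜)} (hψ : ψ ∈ (dual σ (regularGrMod 𝒜)).deg 0) :
    lin φ ψ = 0 := by
  classical
  have := finite_regular (k := k) (𝒜 := 𝒜)
  let A := regularGrMod 𝒜
  let F := free 𝒜 ι d
  let φ' : dual σ A →ₗ[S] dual σ (ker p) := (lin φ :)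
  -- DS vanishes in degree j > 0, so in that degree the kernel is all of F.
  have hdeg : ∀ x ∈ F.deg j, lin p x = 0 := fun x hx => dual_regular_eq_zero hj (lin_mem p hx)
  have hbj : ∀ i, ∀ x ∈ 𝒜 (j - d i), (x • free.basis 𝒜 d i : F) ∈ F.deg j := fun i x hx => by
    have := F.smul_mem' hx (free.basis_mem (𝒜 := 𝒜) d i)
    rwa [sub_add_cancel] at this
  -- the element of the kernel attached to a basis vector and a ring element
  let cm : ℤ → R →+ R := fun l => AddMonoidHom.mk' (A.comp l) (A.comp_add l)
  have hcm : ∀ l x, cm l x ∈ 𝒜 l := A.comp_mem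
  let q : ∀ i, R →+ ker p := fun i =>
    { toFun x := ⟨cm (j - d i) x • free.basis 𝒜 d i, hdeg _ (hbj i _ (hcm _ x))⟩
      map_zero' := Subtype.ext (by
        change cm (j - d i) 0 • free.basis 𝒜 d i = 0
        rw [map_zero, zero_smul])
      map_add' x y := Subtype.ext (by
        change cm (j - d i) (x + y) • free.basis 𝒜 d i = _
        rw [map_add, add_smul]
        rfl) }
  -- Restriction of a functional to R₀, extended by zero: a projection onto the degree 0 part of DR.
  let z : Module.Dual k A → dual σ A := fun ψ => dualMk σ 0 (ψ ∘ₗ A.compLin k 0) fun i hi m hm => by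
    change ψ (A.comp 0 m) = 0
    rw [A.comp_ne 0 i m (by omega) hm, map_zero]
  let Θ : ∀ i, R → Module.Dual k (Module.Dual k A) := fun i x =>
    { toFun ψ := functional σ (φ' (z ψ)) (q i x)
      map_add' ψ₁ ψ₂ := by
        have : z (ψ₁ + ψ₂) = z ψ₁ + z ψ₂ := rfl
        rw [this, map_add]
        rfl
      map_smul' c ψ := by
        have : z (c • ψ) = algebraMap k S c • z ψ := dual_ext fun m => by
          rw [functional_smul, σ.map_algebraMap, ← base_smul, map_smul]
          rfl
        rw [this, map_smul, functional_smul, σ.map_algebraMap, ← base_smul, map_smul]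
        rfl }
  -- The predual of `φ'` on the summand R_{j - d i} of F_j: reflexivity turns the double functional
  -- `Θ i x` into an element of R.
  let θ : ∀ i, R →+ R := fun i => AddMonoidHom.mk' (fun x => (Module.evalEquiv k A).symm (Θ i x))
    fun x y => by
      have : Θ i (x + y) = Θ i x + Θ i y := LinearMap.ext fun ψ => by
        change functional σ (φ' (z ψ)) (q i (x + y)) = _
        rw [map_add, map_add]
        rfl
      rw [this, map_add]
      rfl
  have hθ : ∀ i x (ψ : Module.Dual k A), ψ (θ i x) = functional σ (φ' (z ψ)) (q i x) :=
    fun i x ψ => Module.apply_evalEquiv_symm_apply k _ ψ (Θ i x)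
  have hsep : ∀ x y : A, (∀ ψ : Module.Dual k A, ψ x = ψ y) → x = y := fun x y h =>
    sub_eq_zero.1 ((Module.forall_dual_apply_eq_zero_iff k _).1 fun ψ => by
      rw [map_sub, h, sub_self])
  have hzero : ∀ i, ∀ x ∈ 𝒜 (j - d i), θ i x = 0 := by
    intro i
    -- The source degree is j - d i ≥ j > 0. The two remaining goals are that values lie in R₀ and
    -- that the map is R₀-linear, both tested against functionals.
    refine h0 _ (by have := hd i; omega) (θ i) ?_ ?_
    · intro x _
      have : A.comp 0 (θ i x) = θ i x := hsep _ _ fun ψ => by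
        have h1 := hθ i x (ψ ∘ₗ A.compLin k 0)
        have h2 : z (ψ ∘ₗ A.compLin k 0) = z ψ := dual_ext fun m =>
          congrArg ψ (A.comp_self 0 _ (A.comp_mem 0 m))
        rw [h2, ← hθ i x ψ] at h1
        exact h1
      have h3 := A.comp_mem 0 (θ i x)
      rw [this] at h3
      exact h3
    · intro b hb x hx
      refine hsep _ _ fun ψ => ?_
      have h1 := hθ i x (ψ ∘ₗ A.act k b)
      have h2 : z (ψ ∘ₗ A.act k b) = τ.toFun b • z ψ := dual_ext fun m => by
        rw [functional_smul, hστ]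
        change ψ (b • A.comp 0 m) = ψ (A.comp 0 (b • m))
        have := A.comp_smul hb 0 m
        rw [zero_add] at this
        rw [this]
      have h3 : q i (b * x) = b • q i x := Subtype.ext (by
        have := A.comp_smul hb (j - d i) x
        rw [zero_add] at this
        have h4 : cm (j - d i) (b * x) = b * cm (j - d i) x := this
        change cm (j - d i) (b * x) • free.basis 𝒜 d i = b • (cm (j - d i) x • free.basis 𝒜 d i)
        rw [← mul_smul, h4])
      rw [h2, map_smul, functional_smul, hστ, ← h3, ← hθ] at h1
      exact h1.symm
  have hψz : z (functional σ ψ) = ψ := dual_ext fun m => by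
    have := functional_comp ψ 0 m
    rw [(dual σ A).comp_self _ _ hψ, neg_zero] at this
    exact this.symm
  have hvan : ∀ i, ∀ x ∈ 𝒜 (j - d i), functional σ (φ' ψ) (q i x) = 0 := fun i x hx => by
    have := hθ i x (functional σ ψ)
    rw [hψz, hzero i x hx] at this
    rw [← this]
    exact map_zero (functional σ ψ)
  have hmem : φ' ψ ∈ (dual σ (ker p)).deg (-j) := by
    refine lin_mem φ (i := -j) ?_
    change ψ ∈ (dual σ (regularGrMod 𝒜)).deg (-j + j)
    rwa [neg_add_cancel]
  change φ' ψ = 0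
  refine dual_ext fun y => ?_
  rw [functional_zero, LinearMap.zero_apply]
  induction y using (ker p).induction_homogeneous with
  | h0 => rw [map_zero]
  | hadd x y hx hy => rw [map_add, hx, hy, add_zero]
  | h l y hy =>
    -- The functional `φ' ψ` has degree -j, so only elements of degree j matter; these are sums of
    -- the elements `q i x`.
    by_cases hl : l = j
    · subst hl
      have hy' : (y.1 : F) ∈ F.deg l := hy
      have hyi : ∀ i, (y.1 : ι → R) i ∈ 𝒜 (l - d i) := mem_free_deg.1 hy'
      have hsum : y = ∑ i, q i ((y.1 : ι → R) i) := by
        have hinj : Function.Injective (lin (kerι p)) := Subtype.val_injective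
        apply hinj
        rw [map_sum]
        refine (free.sum_basis (𝒜 := 𝒜) d (y.1 : ι → R)).trans (Finset.sum_congr rfl fun i _ => ?_)
        exact congrArg (fun x : R => x • free.basis 𝒜 d i) (A.comp_self _ _ (hyi i)).symm
      rw [hsum, map_sum]
      exact Finset.sum_eq_zero fun i _ => hvan i _ (hyi i)
    · exact hmem l (by omega) y hy

/-- The matrix coefficient of a functional and an element of a graded module. -/
def coefficient (σ : GradedAntiHom k 𝒜 ℬ) {M : GrMod.{u} 𝒜} (l : M →ₗ[k] k) (x : M) :
    regularGrMod ℬ →ₗ[k] k where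
  toFun s := l (σ.toFun s • x)
  map_add' (s t : S) := by
    change l (σ.toFun (s + t) • x) = _
    rw [σ.map_add, add_smul, map_add]
  map_smul' c (s : S) := by
    have : σ.toFun (algebraMap k S c * s) = algebraMap k R c * σ.toFun s := by
      rw [σ.map_mul, σ.map_algebraMap, Algebra.commutes]
    change l (σ.toFun (algebraMap k S c * s) • x) = _
    rw [this, mul_smul, ← base_smul, map_smul]
    rfl

omit [GradedAlgebra 𝒜] [BaseDegreeZero k 𝒜] [BaseDegreeZero k ℬ] in
theorem coefficient_add {M : GrMod.{u} 𝒜} (l : M →ₗ[k] k) (x y : M) :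
    coefficient σ l (x + y) = coefficient σ l x + coefficient σ l y :=
  LinearMap.ext fun s => by
    change l (σ.toFun s • (x + y)) = l (σ.toFun s • x) + l (σ.toFun s • y)
    rw [smul_add, map_add]

-- This balance makes x ↦ `coefficient σ l x` linear as a map into a graded dual.
omit [GradedAlgebra 𝒜] [BaseDegreeZero k 𝒜] [BaseDegreeZero k ℬ] in
theorem coefficient_smul (hστ : ∀ r, σ.toFun (τ.toFun r) = r) {M : GrMod.{u} 𝒜}
    (l : M →ₗ[k] k) (r : R) (x : M) (s : regularGrMod ℬ) :
    coefficient σ l (r • x) s = coefficient σ l x (τ.toFun r • s) := by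
  have (s : S) : σ.toFun (τ.toFun r * s) = σ.toFun s * r := by rw [σ.map_mul, hστ]
  refine Eq.trans ?_ (congrArg (fun a : R => l (a • x)) (this s).symm)
  change l (σ.toFun s • r • x) = l ((σ.toFun s * r) • x)
  rw [mul_smul]

/-- The dual of the kernel of a free cover has no socle in negative degrees. -/
theorem eq_zero_of_positive_smul_eq_zero [Module.Finite k R] [Module.Finite k S]
    [IsNonnegGraded 𝒜] [IsNonnegGraded ℬ] (hστ : ∀ r, σ.toFun (τ.toFun r) = r)
    (hτσ : ∀ s, τ.toFun (σ.toFun s) = s) (h0 : NoPositiveToZero 𝒜)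
    {ι : Type} [Fintype ι] {d : ι → ℤ} (hd : ∀ i, d i ≤ 0)
    (p : free 𝒜 ι d ⟶ dual τ (regularGrMod ℬ)) [Injective (dual σ (ker p))]
    {j : ℤ} (hj : 0 < j) {c : dual σ (ker p)} (hc : c ∈ (dual σ (ker p)).deg (-j))
    (hpos : ∀ a > 0, ∀ s ∈ ℬ a, s • c = 0) : c = 0 := by
  by_contra hne
  have : IsArtinianRing S := IsArtinianRing.of_finite k S
  let C := dual σ (ker p)
  obtain ⟨r, hr, hsimple⟩ := exists_simple_generator (S := S) hne
  have hcyc : ∀ s : S, s • c ∈ C.deg (-j) := fun s => by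
    obtain ⟨s₀, h₀, h⟩ := smul_eq_comp_zero_smul hpos s
    rw [h]
    have := C.smul_mem' h₀ hc
    rwa [zero_add] at this
  have hposr : ∀ a > 0, ∀ s ∈ ℬ a, ∀ t : S, s • t • c = 0 := fun a ha s hs t => by
    obtain ⟨t₀, h₀, h⟩ := smul_eq_comp_zero_smul hpos t
    rw [h, ← mul_smul]
    refine hpos a ha _ ?_
    have := SetLike.GradedMul.mul_mem hs h₀
    rwa [add_zero] at this
  let W : Submodule S C := Submodule.span S {r • c}
  have hW : ∀ x ∈ W, ∃ t : S, x = t • r • c := fun x hx => by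
    obtain ⟨t, rfl⟩ := Submodule.mem_span_singleton.1 hx
    exact ⟨t, rfl⟩
  have hWdeg : ∀ x ∈ W, x ∈ C.deg (-j) := fun x hx => by
    obtain ⟨t, rfl⟩ := hW x hx
    rw [← mul_smul]
    exact hcyc _
  have hWhom : C.IsHomogeneousSub W := fun i x hx => by
    by_cases hi : i = -j
    · rw [hi, C.comp_self _ _ (hWdeg x hx)]
      exact hx
    · rw [C.comp_ne i (-j) x hi (hWdeg x hx)]
      exact zero_mem _
  let N := C.sub W hWhom
  -- One functional suffices to embed N in DR(j), because N is simple and generated by `r • c`.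
  obtain ⟨l, hl⟩ : ∃ l : Module.Dual k C, l (r • c) ≠ 0 := by
    by_contra h
    push Not at h
    exact hr ((Module.forall_dual_apply_eq_zero_iff k _).1 h)
  let inc : N ⟶ C := homMk (M := N) (N := C) W.subtype fun _ _ h => h
  have hincmem : ∀ x : N, lin inc x ∈ W := fun x => x.2
  let β : N → regularGrMod 𝒜 →ₗ[k] k := fun x => coefficient τ l (lin inc x)
  have hadd : ∀ x y, β (x + y) = β x + β y := fun x y => by
    rw [← coefficient_add, ← map_add]
  have hsmul : ∀ s x (a : regularGrMod 𝒜), β (s • x) a = β x (σ.toFun s • a) := fun s x a => by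
    rw [← coefficient_smul hτσ, ← map_smul]
  have hdeg : ∀ a b, b + (a + j) ≠ 0 → ∀ x ∈ N.deg a, ∀ m ∈ (regularGrMod 𝒜).deg b,
      β x m = 0 := by
    intro a b hab x hx m hm
    change l (τ.toFun m • lin inc x) = 0
    have hm' : m ∈ 𝒜 b := hm
    by_cases ha : a = -j
    · rcases lt_trichotomy b 0 with hb | hb | hb
      · have h1 : τ.toFun m = 0 := eq_zero_of_mem_neg (𝒜 := ℬ) hb (τ.map_mem hm')
        rw [h1, zero_smul, map_zero]
      · omega
      · obtain ⟨t, ht⟩ := hW _ (hincmem x)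
        rw [ht, ← mul_smul t, hposr b hb _ (τ.map_mem hm') _, map_zero]
    · have h1 : lin inc x = 0 :=
        C.eq_zero_of_mem_of_mem ha (lin_mem inc hx) (hWdeg _ (hincmem x))
      rw [h1, smul_zero, map_zero]
  let μ : N ⟶ (dual σ (regularGrMod 𝒜)).shift j :=
    homMk (M := N) (N := (dual σ (regularGrMod 𝒜)).shift j)
      (pairLin σ j β hadd hsmul hdeg :) fun i x hx => pairLin_mem j β hadd hsmul hdeg hx
  have hμ : ∀ x a, functional σ (M := regularGrMod 𝒜) (lin μ x) a = l (τ.toFun a • lin inc x) :=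
    fun x a => rfl
  have hμinj : Function.Injective (lin μ) := by
    rw [← LinearMap.ker_eq_bot, eq_bot_iff]
    intro x hx
    by_contra hx0
    obtain ⟨s, hs⟩ := hW _ (hincmem x)
    have hne' : s • r • c ≠ 0 := fun h => hx0 (Subtype.ext (hs.trans h))
    -- A nonzero element of N can be multiplied back to the generator, where `l` does not vanish.
    obtain ⟨t, ht⟩ := hsimple s hne'
    have h1 := hμ x (σ.toFun t)
    rw [hτσ, hs, ht, LinearMap.mem_ker.1 hx] at h1
    exact hl h1.symm
  have := mono_of_injective μ hμinj
  let φ : (dual σ (regularGrMod 𝒜)).shift j ⟶ C := Injective.factorThru inc μ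
  have hφ : μ ≫ φ = inc := Injective.comp_factorThru _ _
  let w : N := ⟨r • c, Submodule.mem_span_singleton_self _⟩
  have hw : w ∈ N.deg (-j) := hcyc r
  have hψ := lin_mem μ hw
  change lin μ w ∈ (dual σ (regularGrMod 𝒜)).deg (-j + j) at hψ
  -- Unshifted, the image of the generator has degree 0, exactly where `φ` is known to vanish.
  rw [neg_add_cancel] at hψ
  have h1 := map_dual_regular_eq_zero hστ h0 hd p hj φ hψ
  have h2 : lin φ (lin μ w) = r • c := LinearMap.congr_fun (congrArg lin hφ) w
  exact hr (h2.symm.trans h1)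

/-- There are no nonzero morphisms from a positive shift of the kernel of a free cover of `D S` to
the regular module. -/
theorem hom_ker_shift_eq_zero [Module.Finite k R] [Module.Finite k S]
    [IsNonnegGraded 𝒜] [IsNonnegGraded ℬ] (hστ : ∀ r, σ.toFun (τ.toFun r) = r)
    (hτσ : ∀ s, τ.toFun (σ.toFun s) = s) (h0 : NoPositiveToZero 𝒜)
    {ι : Type} [Fintype ι] {d : ι → ℤ} (hd : ∀ i, d i ≤ 0)
    (p : free 𝒜 ι d ⟶ dual τ (regularGrMod ℬ)) [Injective (dual σ (ker p))]
    {n : ℤ} (hn : 0 < n) (f : (ker p).shift n ⟶ regularGrMod 𝒜) : f = 0 := by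
  let A := regularGrMod 𝒜
  let C := dual σ (ker p)
  let f' : ker p →ₗ[R] A := (lin f :)
  have hf' : ∀ b, ∀ m ∈ (ker p).deg b, f' m ∈ A.deg (b - n) := fun b m hm => by
    refine lin_mem f (i := b - n) ?_
    change m ∈ (ker p).deg (b - n + n)
    rwa [sub_add_cancel]
  let β : dual σ A → ker p →ₗ[k] k := fun ψ => functional σ ψ ∘ₗ baseLin k f'
  have hsmul : ∀ s ψ (m : ker p), β (s • ψ) m = β ψ (σ.toFun s • m) := fun s ψ m => by
    change functional σ ψ (σ.toFun s • f' m) = functional σ ψ (f' (σ.toFun s • m))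
    rw [f'.map_smul]
  have hdeg : ∀ a b, b + (a + -n) ≠ 0 → ∀ ψ ∈ (dual σ A).deg a, ∀ m ∈ (ker p).deg b,
      β ψ m = 0 := fun a b hab ψ hψ m hm => hψ (b - n) (by omega) _ (hf' b m hm)
  -- The dual of `f`, lowering degrees by n.
  let g : dual σ A →ₗ[S] C := pairLin σ (-n) β (fun _ _ => rfl) hsmul hdeg
  have hg : ∀ ψ m, functional σ (g ψ) m = functional σ ψ (f' m) := fun ψ m => rfl
  have hgdeg : ∀ e, ∀ ψ ∈ (dual σ A).deg e, g ψ ∈ C.deg (e + -n) :=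
    fun e ψ hψ => pairLin_mem (σ := σ) (-n) β (fun _ _ => rfl) hsmul hdeg hψ
  have hzero : ∀ e, ∀ ψ ∈ (dual σ A).deg e, g ψ = 0 := by
    by_contra hex
    push Not at hex
    -- In the top degree e where `g` is nonzero, positive-degree scalars push ψ into degrees that
    -- `g` kills. As e ≤ 0, the value `g ψ` has degree -(n - e) with n - e > 0.
    obtain ⟨e, ⟨ψ, hψ, hne⟩, hmax⟩ := Int.exists_greatest_of_bdd
      (P := fun e => ∃ ψ ∈ (dual σ A).deg e, g ψ ≠ 0)
      ⟨0, fun e ⟨ψ, hψ, hne⟩ => not_lt.1 fun he => hne (by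
        rw [dual_regular_eq_zero he hψ, map_zero])⟩ hex
    have he : e ≤ 0 := not_lt.1 fun he => hne (by rw [dual_regular_eq_zero he hψ, map_zero])
    refine hne (eq_zero_of_positive_smul_eq_zero hστ hτσ h0 hd p (j := n - e) (by omega) ?_ ?_)
    · have := hgdeg e ψ hψ
      rwa [show e + -n = -(n - e) by omega] at this
    · intro a ha s hs
      by_contra hsne
      rw [← map_smul g] at hsne
      have := hmax (a + e) ⟨s • ψ, (dual σ A).smul_mem' hs hψ, hsne⟩
      omega
  have hg0 : ∀ ψ, g ψ = 0 := fun ψ => by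
    induction ψ using (dual σ A).induction_homogeneous with
    | h0 => exact map_zero g
    | hadd x y hx hy => rw [map_add, hx, hy, add_zero]
    | h e ψ hψ => exact hzero e ψ hψ
  refine hom_ext' (LinearMap.ext fun m => ?_)
  refine eq_zero_of_forall_functional σ (M := A) fun ψ => ?_
  have := hg ψ m
  rw [hg0] at this
  exact this.symm

/-! ### Vanishing of Ext¹ into the regular module -/

section Ext

open Abelian

/-- `Ext¹` from positive shifts of `D S` to the regular module vanishes. -/
theorem subsingleton_ext_dual_regular_shift [HasExt.{v} (GrMod.{u} 𝒜)] [Module.Finite k R]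
    [Module.Finite k S] [IsNonnegGraded 𝒜] [IsNonnegGraded ℬ]
    [HasInjectiveDimensionLE (regularGrMod ℬ) 1]
    (hστ : ∀ r, σ.toFun (τ.toFun r) = r)
    (hτσ : ∀ s, τ.toFun (σ.toFun s) = s) (h0 : NoPositiveToZero 𝒜) {n : ℤ} (hn : 0 < n) :
    Subsingleton (Ext ((dual τ (regularGrMod ℬ)).shift n) (regularGrMod 𝒜) 1) := by
  have := finite_regular (k := k) (𝒜 := ℬ)
  have : Module.Finite k (dual τ (regularGrMod ℬ)) :=
    Module.Finite.of_injective (functionalLin τ _) (functionalLin_injective _)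
  obtain ⟨ι, _, d, p, hp, hd⟩ := exists_free_cover (k := k) (dual τ (regularGrMod ℬ))
  have hd0 : ∀ i, d i ≤ 0 := fun i => not_lt.1 fun hi => by
    obtain ⟨m, hm, hne⟩ := hd i
    exact hne (dual_regular_eq_zero hi hm)
  have : Injective (dual σ (ker p)) := injective_dual_ker hστ hτσ p hp
  have hw : shiftMap (kerι p) n ≫ shiftMap p n = 0 :=
    hom_ext' (congrArg lin (kerι_comp p) :)
  have hinj : Function.Injective (lin (kerι p)) := Subtype.val_injective
  have hS : (ShortComplex.mk (shiftMap (kerι p) n) (shiftMap p n) hw).ShortExact :=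
    shortExact_of_lin (shiftMap (kerι p) n) (shiftMap p n) hinj hp hw fun x hx => ⟨⟨x, hx⟩, rfl⟩
  have : Projective (ShortComplex.mk (shiftMap (kerι p) n) (shiftMap p n) hw).X₂ :=
    projective_shift (M := free 𝒜 ι d) n
  exact subsingleton_ext_one_of_shortExact hS fun f =>
    hom_ker_shift_eq_zero hστ hτσ h0 hd0 p hn f

/-- `Ext¹` from finite-dimensional modules concentrated in a negative degree to the regular module
vanishes. -/
theorem subsingleton_ext_of_concentrated [HasExt.{v} (GrMod.{u} 𝒜)] [Module.Finite k R]
    [Module.Finite k S] [IsNonnegGraded 𝒜] [IsNonnegGraded ℬ]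
    [HasInjectiveDimensionLE (regularGrMod ℬ) 1] [HasInjectiveDimensionLE (regularGrMod 𝒜) 1]
    (hστ : ∀ r, σ.toFun (τ.toFun r) = r)
    (hτσ : ∀ s, τ.toFun (σ.toFun s) = s) (h0 : NoPositiveToZero 𝒜) {n : ℤ} (hn : 0 < n)
    (X : GrMod.{u} 𝒜) [Module.Finite k X] (hX : ∀ i ≠ -n, ∀ x ∈ X.deg i, x = 0) :
    Subsingleton (Ext X (regularGrMod 𝒜) 1) := by
  induction hN : Module.finrank k X using Nat.strong_induction_on generalizing X with
  | _ N ih =>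
  by_cases hzero : ∀ x : X, x = 0
  · refine subsingleton_of_forall_eq 0 fun e => ?_
    rw [← e.mk₀_id_comp, (isZero_of_forall_eq_zero hzero).eq_zero_of_src (𝟙 X), Ext.mk₀_zero,
      Ext.zero_comp]
  push Not at hzero
  obtain ⟨x₀, hx₀⟩ := hzero
  obtain ⟨l, hl⟩ : ∃ l : Module.Dual k X, l x₀ ≠ 0 := by
    by_contra h
    push Not at h
    exact hx₀ ((Module.forall_dual_apply_eq_zero_iff k _).1 h)
  have hdeg : ∀ a b, b + (a + n) ≠ 0 → ∀ x ∈ X.deg a, ∀ s ∈ (regularGrMod ℬ).deg b,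
      coefficient σ l x s = 0 := by
    intro a b hab x hx s hs
    change l (σ.toFun s • x) = 0
    have hs' : s ∈ ℬ b := hs
    by_cases ha : a = -n
    · rw [hX (b + a) (by omega) _ (X.smul_mem' (σ.map_mem hs') hx), map_zero]
    · rw [hX a ha x hx, smul_zero, map_zero]
  let q : X ⟶ (dual τ (regularGrMod ℬ)).shift n :=
    homMk (M := X) (N := (dual τ (regularGrMod ℬ)).shift n)
      (pairLin τ n (coefficient σ l) (coefficient_add l) (coefficient_smul hστ l) hdeg :)
      fun i x hx => pairLin_mem n _ (coefficient_add l) (coefficient_smul hστ l) hdeg hx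
  -- Evaluating a matrix coefficient at 1 recovers `l`; hence the kernel of `q` lies in the proper
  -- subspace ker l and has smaller dimension.
  have hq : ∀ x, lin q x = 0 → l x = 0 := fun x hx => by
    have h1 : functional τ (M := regularGrMod ℬ) (lin q x) (1 : S) = l (σ.toFun 1 • x) := rfl
    rw [hx, σ.map_one, one_smul] at h1
    exact h1.symm
  let κ := kernel.ι q
  have hκinj : Function.Injective (lin κ) := injective_of_mono κ
  have hκ : ∀ y, l (lin κ y) = 0 := fun y =>
    hq _ (LinearMap.congr_fun (congrArg lin (kernel.condition q)) y)
  have : Module.Finite k (kernel q : GrMod.{u} 𝒜) :=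
    Module.Finite.of_injective (baseLin k (lin κ)) hκinj
  refine subsingleton_ext_one_of_hom (Y := regularGrMod 𝒜) q
    (subsingleton_ext_dual_regular_shift hστ hτσ h0 hn) (ih _ ?_ (kernel q) ?_ rfl)
  · rw [← hN, ← LinearMap.finrank_range_of_inj (f := baseLin k (lin κ)) hκinj]
    refine Submodule.finrank_lt fun h => hl ?_
    have : x₀ ∈ LinearMap.range (baseLin k (lin κ)) := h ▸ Submodule.mem_top
    obtain ⟨y, rfl⟩ := this
    exact hκ y
  · intro i hi y hy
    exact hκinj ((hX i hi _ (lin_mem κ hy)).trans (map_zero _).symm)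

end Ext

end GrMod

/-! ### Hereditary rings -/

/-- Over a ring of global dimension at most one, submodules of projective modules are projective. -/
theorem projective_submodule_of_globalDim_le {R : Type u} [Ring R] (h : globalDim R ≤ 1)
    {M : Type u} [AddCommGroup M] [Module R M] [Module.Projective R M] (N : Submodule R M) :
    Module.Projective R N := by
  have hS := LinearMap.shortExact_shortComplexKer (f := N.mkQ) N.mkQ_surjective
  have h3 : HasProjectiveDimensionLT (ModuleCat.of R (M ⧸ N)) 2 :=
    (projectiveDimension_le_iff _ 1).1 ((le_iSup (fun M : ModuleCat.{u} R =>
      projectiveDimension M) _).trans h)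
  have h2 : Projective (ModuleCat.of R M) := (IsProjective.iff_projective M).1 inferInstance
  have h1 := hS.hasProjectiveDimensionLT_X₁ 1
    (inferInstanceAs (HasProjectiveDimensionLT (ModuleCat.of R M) 1)) h3
  have h0 := projective_iff_hasProjectiveDimensionLT_one.2 h1
  have : Module.Projective R (LinearMap.ker N.mkQ) := (IsProjective.iff_projective _).2 h0
  exact Module.Projective.of_equiv (LinearEquiv.ofEq _ _ N.ker_mkQ)

/-- Over a hereditary ring, a module without nonzero projective direct summands has no nonzero
homomorphisms to projective modules. -/
theorem linearMap_eq_zero_of_no_projective_summand {R : Type u} [Ring R] (h : globalDim R ≤ 1)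
    {E : Type v} [AddCommGroup E] [Module R E]
    (hE : ∀ P Q : Submodule R E, IsCompl P Q → Module.Projective R P → P = ⊥)
    {M : Type u} [AddCommGroup M] [Module R M] [Module.Projective R M] (f : E →ₗ[R] M) :
    f = 0 := by
  have := projective_submodule_of_globalDim_le h (LinearMap.range f)
  obtain ⟨s, hs⟩ := Module.projective_lifting_property f.rangeRestrict LinearMap.id
    f.surjective_rangeRestrict
  have hs' : ∀ y, f.rangeRestrict (s y) = y := LinearMap.congr_fun hs
  -- The image of `f` is projective, so a section `s` embeds it in E as a direct summand.
  have hc : IsCompl (LinearMap.range s) (LinearMap.ker (s.rangeRestrict ∘ₗ f.rangeRestrict)) := by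
    refine LinearMap.isCompl_of_proj ?_
    rintro ⟨_, y, rfl⟩
    exact Subtype.ext (congrArg s (hs' y))
  have hinj : Function.Injective s := Function.LeftInverse.injective hs'
  have hbot := hE _ _ hc (Module.Projective.of_equiv (LinearEquiv.ofInjective s hinj))
  ext x
  have hx : s (f.rangeRestrict x) = 0 := by
    have : s (f.rangeRestrict x) ∈ LinearMap.range s := ⟨_, rfl⟩
    rwa [hbot, Submodule.mem_bot] at this
  have hx' : f.rangeRestrict x = 0 := hinj (hx.trans (map_zero s).symm)
  exact congrArg Subtype.val hx'

/-! ### Right modules over A and the conclusion -/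

section Opposite

variable {K : Type w} {A : Type u} [Field K] [Ring A] [Algebra K A] (𝒜 : ℤ → Submodule K A)

section

variable (k : Type*) [Field k] [Algebra k A]

instance [BaseDegreeZero k 𝒜] : BaseDegreeZero k (opGrading 𝒜) where
  algebraMap_mem c := BaseDegreeZero.algebraMap_mem (𝒜 := 𝒜) c

/-- The tautological anti-homomorphism from the opposite algebra. -/
def unopAnti : GradedAntiHom k 𝒜 (opGrading 𝒜) where
  toFun := MulOpposite.unop
  map_one := rfl
  map_zero := rfl
  map_add _ _ := rfl
  map_mul _ _ := rfl
  map_algebraMap _ := rfl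
  map_mem h := h

/-- The tautological anti-homomorphism to the opposite algebra. -/
def opAnti : GradedAntiHom k (opGrading 𝒜) 𝒜 where
  toFun := MulOpposite.op
  map_one := rfl
  map_zero := rfl
  map_add _ _ := rfl
  map_mul _ _ := rfl
  map_algebraMap _ := rfl
  map_mem h := h

end

/-- If `A₀` is hereditary and the right `A₀`-module `A_{>0}` has no nonzero projective direct
summands, then there are no nonzero right `A₀`-linear maps from the homogeneous parts of positive
degree to `A₀`. -/
theorem noPositiveToZero_opGrading [GradedAlgebra 𝒜] (hgldim : globalDim (𝒜 0)ᵐᵒᵖ = 1)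
    (hproj : ∀ P Q : Submodule (𝒜 0)ᵐᵒᵖ (positivePart 𝒜), IsCompl P Q →
      Module.Projective (𝒜 0)ᵐᵒᵖ P → P = ⊥) :
    GrMod.NoPositiveToZero (opGrading 𝒜) := by
  classical
  intro m hm θ hθ hmul x hx
  let dc : A →ₗ[K] A := GradedAlgebra.proj 𝒜 m
  have hdc : ∀ y, dc y ∈ 𝒜 m := fun y => SetLike.coe_mem (DirectSum.decompose 𝒜 y m)
  have hdcs : ∀ y ∈ 𝒜 m, dc y = y := fun y hy => DirectSum.decompose_of_mem_same 𝒜 hy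
  have hdcmul : ∀ y, ∀ b ∈ 𝒜 0, dc (y * b) = dc y * b := fun y b hb => by
    have := DirectSum.coe_decompose_mul_add_of_right_mem 𝒜 (i := m) (a := y) hb
    rwa [add_zero] at this
  -- Precomposing `θ` with the projection to degree m extends it to all of A_{>0}; the target is A₀
  -- as a right module over itself.
  let F : positivePart 𝒜 →ₗ[(𝒜 0)ᵐᵒᵖ] (𝒜 0)ᵐᵒᵖ :=
    { toFun y := MulOpposite.op ⟨(θ (MulOpposite.op (dc y))).unop, hθ _ (hdc y)⟩
      map_add' y z := MulOpposite.unop_injective (Subtype.ext (by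
        change (θ (MulOpposite.op (dc (y + z : A)))).unop = _
        rw [map_add, MulOpposite.op_add, map_add]
        rfl))
      map_smul' b y := MulOpposite.unop_injective (Subtype.ext (by
        change (θ (MulOpposite.op (dc ((y : A) * (b.unop : A))))).unop = _
        rw [hdcmul _ _ b.unop.2, MulOpposite.op_mul, hmul _ b.unop.2 _ (hdc y)]
        rfl)) }
  have hF : F = 0 := linearMap_eq_zero_of_no_projective_summand hgldim.le hproj F
  have hx' : x.unop ∈ positivePart 𝒜 :=
    Submodule.mem_iSup_of_mem (p := fun i : {i : ℤ // 0 < i} => 𝒜 i) ⟨m, hm⟩ hx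
  have h1 := congrArg (fun y : (𝒜 0)ᵐᵒᵖ => (y.unop : A)) (LinearMap.congr_fun hF ⟨x.unop, hx'⟩)
  have h2 : (θ (MulOpposite.op (dc x.unop))).unop = 0 := h1
  rw [hdcs x.unop hx] at h2
  exact MulOpposite.unop_injective h2

theorem topGrMod_deg_eq_zero [FiniteDimensional K A] [GradedAlgebra 𝒜] [IsNonnegGraded 𝒜] {i : ℤ}
    (hi : i ≠ 0) {x : topGrMod 𝒜} (hx : x ∈ (topGrMod 𝒜).deg i) : x = 0 := by
  obtain ⟨y, hy, rfl⟩ := hx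
  have hy' : y ∈ 𝒜 i := hy
  refine (Submodule.Quotient.mk_eq_zero _).2 ?_
  rcases lt_or_gt_of_ne hi with h | h
  · have h0 : y = (0 : A) := GrMod.eq_zero_of_mem_neg (R := A) h hy'
    rw [h0]
    exact zero_mem _
  · exact pos_mem_jacobson 𝒜 h hy'

attribute [local instance 50] GrMod.baseModule

/-- The vanishing of all extensions of the top, shifted by a positive number, by the algebra. -/
theorem subsingleton_ext_top_shift [FiniteDimensional K A] [GradedAlgebra 𝒜] [IsNonnegGraded 𝒜]
    (k : Type u) [Field k] [Algebra k A] [Module.Finite k A] [BaseDegreeZero k 𝒜]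
    (hIG : IsGradedIG 𝒜 1) (h0 : GrMod.NoPositiveToZero (opGrading 𝒜))
    [HasExt.{v} (GrMod.{u} (opGrading 𝒜))] {i : ℤ} (hi : 0 < i) (n : ℕ) :
    Subsingleton (Abelian.Ext ((topGrMod (opGrading 𝒜)).shift i)
      (regularGrMod (opGrading 𝒜)) n) := by
  let X := (topGrMod (opGrading 𝒜)).shift i
  have hX : ∀ a ≠ -i, ∀ x ∈ X.deg a, x = 0 := fun a ha x hx =>
    topGrMod_deg_eq_zero (opGrading 𝒜) (i := a + i) (by omega) hx
  have := hIG.1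
  have := hIG.2
  have : Module.Finite k Aᵐᵒᵖ := Module.Finite.equiv (MulOpposite.opLinearEquiv k)
  match n with
  | 0 =>
    refine subsingleton_of_forall_eq 0 fun e => ?_
    obtain ⟨f, rfl⟩ := Abelian.Ext.addEquiv₀.symm.surjective e
    have hf : f = 0 := GrMod.hom_ext' (LinearMap.ext fun x => by
      change GrMod.lin f x = 0
      induction x using X.induction_homogeneous with
      | h0 => exact map_zero (GrMod.lin f)
      | hadd x y hx hy => rw [map_add (GrMod.lin f), hx, hy, add_zero]
      | h a x hx =>
        by_cases ha : a = -i
        · exact GrMod.eq_zero_of_mem_neg (𝒜 := opGrading 𝒜) (by omega) (GrMod.lin_mem f hx)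
        · rw [hX a ha x hx]
          exact map_zero (GrMod.lin f))
    rw [hf, map_zero]
  | 1 =>
    have : Module.Finite Aᵐᵒᵖ X :=
      inferInstanceAs (Module.Finite Aᵐᵒᵖ (Aᵐᵒᵖ ⧸ (Ring.jacobson Aᵐᵒᵖ)))
    have : Module.Finite k X := Module.Finite.trans Aᵐᵒᵖ _
    exact GrMod.subsingleton_ext_of_concentrated (k := k) (σ := opAnti 𝒜 k) (τ := unopAnti 𝒜 k)
      (fun _ => rfl) (fun _ => rfl) h0 hi X hX
  | n + 2 => exact HasInjectiveDimensionLT.subsingleton _ 2 (n + 2) (by omega) _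

end Opposite

theorem mainTheorem9 {K : Type w} {A : Type u} [Field K] [Ring A] [Algebra K A]
    [FiniteDimensional K A] (𝒜 : ℤ → Submodule K A) [GradedAlgebra 𝒜] [IsNonnegGraded 𝒜]
    (hIG : IsGradedIG 𝒜 1)
    (hgldim : globalDim (𝒜 0)ᵐᵒᵖ = 1)
    (hproj : ∀ P Q : Submodule (𝒜 0)ᵐᵒᵖ (positivePart 𝒜), IsCompl P Q →
      Module.Projective (𝒜 0)ᵐᵒᵖ P → P = ⊥) :
    gRight 𝒜 ≤ 0 := by
  have h0 := noPositiveToZero_opGrading 𝒜 hgldim hproj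
  refine sSup_le ?_
  rintro _ ⟨i, rfl, n, hn⟩
  refine WithBotTop.coe_le_coe.2 (not_lt.1 fun hi => ?_)
  let := HasExt.standard (GrMod.{u} (opGrading 𝒜))
  refine not_subsingleton_iff_nontrivial.2 hn ?_
  -- For A ≠ 0 the field embeds in A, so it can be replaced by a copy in the universe of A, as
  -- needed for duals to stay in the same module category. The zero algebra has no such embedding,
  -- but there the regular module is zero.
  rcases subsingleton_or_nontrivial A with hA | hA
  · have hz : IsZero (regularGrMod (opGrading 𝒜)) :=
      GrMod.isZero_of_forall_eq_zero fun x : Aᵐᵒᵖ => Subsingleton.elim x 0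
    have := hz.hasInjectiveDimensionLT_zero
    exact HasInjectiveDimensionLT.subsingleton _ 0 n n.zero_le _
  · have : Small.{u} K := small_of_injective (algebraMap K A).injective
    let k := Shrink.{u} K
    let e : k ≃+* K := Shrink.ringEquiv K
    let : Algebra k K := (e : k →+* K).toAlgebra
    let : Algebra k A := Algebra.compHom A (e : k →+* K)
    have : IsScalarTower k K A := IsScalarTower.of_algebraMap_eq fun _ => rfl
    have : Module.Finite k K := Module.Finite.of_surjective (Algebra.linearMap k K) e.surjective
    have : Module.Finite k A := Module.Finite.trans K A
    have : BaseDegreeZero k 𝒜 := ⟨fun c => SetLike.algebraMap_mem_graded 𝒜 (e c)⟩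
    exact subsingleton_ext_top_shift 𝒜 k hIG h0 hi n
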